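/- Let $\{\rho_\theta:\theta\in\Theta\subset\mathbb R^d\}$ be a family of quantum states (density operators) on a finite-dimensional Hilbert space $\mathcal H$, let $\theta_0$ be an interior point of $\Theta$, write $\rho=\rho_{\theta_0}$, and let $(L_1,\dots,L_d)$ be symmetric logarithmic derivatives at $\theta_0$, i.e. selfadjoint operators with $\partial_i\rho_\theta|_{\theta=\theta_0}=\frac12(\rho L_i+L_i\rho)$. Let $K_\rho=\{K: K\rho=\rho K=0\}$ and let $\mathcal D_\rho$ be the commutation operator: $\mathcal D_\rho X$ is the class modulo $K_\rho$ of the operators $Y$ with $\rho Y+Y\rho=\sqrt{-1}(\rho X-X\rho)$. Let $(X_1,\dots,X_r)$ be selfadjoint operators on $\mathcal H$ such that $\mathrm{Tr}\,\rho X_i=0$ for all $i$, the classes of $X_1,\dots,X_r$ modulo $K_\rho$ are linearly independent over $\mathbb R$, $\mathrm{Span}_{\mathbb R}\{L_k\}\subset V:=\mathrm{Span}_{\mathbb R}\{X_i\}$, and $V$ is $\mathcal D_\rho$-invariant (for each $X\in V$ the class $\mathcal D_\rho X$ contains an element of $V$). Put $$\Delta^{(n)}_k=\frac1{\sqrt n}\sum_{j=1}^n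 I^{\otimes(j-1)}\otimes L_k\otimes I^{\otimes(n-j)},\qquad X^{(n)}_i=\frac1{\sqrt n}\sum_{j=1}^n I^{\otimes(j-1)}\otimes X_i\otimes I^{\otimes(n-j)},$$ and $\Sigma_{ij}=\mathrm{Tr}\,\rho X_jX_i$, $A_{ij}=\mathrm{Tr}\sqrt\rho X_i\sqrt\rho X_j$. For positive semidefinite $P,Q$ let $P\#Q$ be their operator geometric mean, i.e. the largest $Z\ge0$ with $\begin{pmatrix}P&Z\\Z&Q\end{pmatrix}\ge0$. Then: 1. There is a real $r\times d$ matrix $F$ with $\Delta^{(n)}_k=\sum_{i=1}^r F^i_kX^{(n)}_i$ for all $n$ and $k$; and $r\ge d$ if $L_1,\dots,L_d$ are linearly independent. 2. $\Sigma\ge0$, $\mathrm{Re}\,\Sigma>0$, and $X^{(n)}$ converges in distribution under $\rho^{\otimes n}$ to the quantum Gaussian state $N(0,\Sigma)$, i.e. for all $T\in\mathbb N$ and $\xi_1,\dots,\xi_T\in\mathbb R^r$, $$\lim_{n\to\infty}\mathrm{Tr}\,\rho^{\otimes n}\prod_{t=1}^Te^{\sqrt{-1}\,\xi_t^iX^{(n)}_i}=\exp\Big(-\tfrac12\sum_{t}\xi_t^i\xi_t^j\Sigma_{ji}-\sum_{t<u}\xi_t^i\xi_u^j\Sigma_{ji}\Big).$$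 3. For all $\xi,\eta\in\mathbb R^r$, $$\lim_{n\to\infty}\mathrm{Tr}\sqrt{\rho^{\otimes n}}\,e^{\sqrt{-1}\,\xi^iX^{(n)}_i}\sqrt{\rho^{\otimes n}}\,e^{\sqrt{-1}\,\eta^iX^{(n)}_i}=\exp\left[-\frac12\begin{pmatrix}\xi\\\eta\end{pmatrix}^{\!\top}\begin{pmatrix}\Sigma&\Sigma\#\Sigma^\top\\\Sigma\#\Sigma^\top&\Sigma^\top\end{pmatrix}\begin{pmatrix}\xi\\\eta\end{pmatrix}\right],$$ and $A=\Sigma\#\Sigma^\top$. In particular, whenever the i.i.d. extension $\{\rho_\theta^{\otimes n}:\theta\in\Theta\}$ is quantum locally asymptotically normal (q-LAN) at $\theta_0$ with the observables $\Delta^{(n)}$, one has $r\ge d$ and the extension is $D$-extendible at $\theta_0$. Here q-LAN at $\theta_0$ with $\Delta^{(n)}$ means that $\Delta^{(n)}$ converges in distribution under $\rho_{\theta_0}^{\otimes n}$ to $N(0,J)$ for some $J\ge0$ with $\mathrm{Re}\,J>0$ and that, for every $h\in\mathbb R^d$, there are positive operators $R^{(n)}_h$ with $\rho_{\theta_0+h/\sqrt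 n}^{\otimes n}-R_h^{(n)}\rho_{\theta_0}^{\otimes n}R_h^{(n)}$ positive and of zero trace against $\rho_{\theta_0}^{\otimes n}$ (for large $n$) such that $\log\big(R^{(n)}_h+o_{L^2}\big)^2=h^i\Delta^{(n)}_i-\frac12(h^ih^jJ_{ij})I+o_D$, with selfadjoint remainders, where $\mathrm{Tr}\,\rho_{\theta_0}^{\otimes n}(o_{L^2})^2\to0$ and adding real multiples of $o_D$ to the exponents does not change the limits of $\mathrm{Tr}\,\rho_{\theta_0}^{\otimes n}\prod_te^{\sqrt{-1}\,\xi_t h^i\Delta^{(n)}_i}$. And $D$-extendible means that it is q-LAN in this sense and that some $r\ge d$ and observables $X_1^{(n)},\dots,X_r^{(n)}$ satisfy 1.-3. for some real $F$ and some $\Sigma\ge0$ with $\mathrm{Re}\,\Sigma>0$. -/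

import Mathlib

/-! Quantum systems on the finite-dimensional Hilbert space `ℂ^ι` are described by complex matrices
indexed by the finite type `ι`; the `n`-fold tensor power of `ℂ^ι` is `ℂ^(Fin n → ι)`. -/

open Filter Topology
open scoped ComplexOrder

noncomputable section

namespace QuantumIID

/-! ### States and functional calculus -/

/-- Quantum states (density matrices). -/
structure IsState {κ : Type*} [Fintype κ] (ρ : Matrix κ κ ℂ) : Prop where
  posSemidef : ρ.PosSemidef
  trace_eq_one : ρ.trace = 1

/-- The positive square root of a positive semidefinite matrix, by functional calculus. -/
def msqrt {κ : Type*} [Fintype κ] [DecidableEq κ] (A : Matrix κ κ ℂ) : Matrix κ κ ℂ :=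
  cfc Real.sqrt A

/-- The logarithm of a positive definite matrix, by functional calculus. -/
def mlog {κ : Type*} [Fintype κ] [DecidableEq κ] (A : Matrix κ κ ℂ) : Matrix κ κ ℂ :=
  cfc Real.log A

/-- The linear combination `ξ^i X_i` of observables with real coefficients. -/
def lin {κ : Type*} {r : ℕ} (ξ : Fin r → ℝ) (X : Fin r → Matrix κ κ ℂ) : Matrix κ κ ℂ :=
  ∑ i, (ξ i : ℂ) • X i

/-- The unitary `exp (√-1 A)`. -/
def expI {κ : Type*} [Fintype κ] [DecidableEq κ] (A : Matrix κ κ ℂ) : Matrix κ κ ℂ :=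
  NormedSpace.exp (Complex.I • A)

/-- A real vector, regarded as a complex one. -/
def toC {α : Type*} (ξ : α → ℝ) : α → ℂ := fun a => (ξ a : ℂ)

/-- The entrywise real part of a complex matrix. -/
def rePart {α : Type*} (J : Matrix α α ℂ) : Matrix α α ℝ := J.map Complex.re

/-! ### Tensor powers -/

/-- The tensor product `A 0 ⊗ ⋯ ⊗ A (n - 1)` acting on `(ℂ^ι)^{⊗ n}`. -/
def tensor {ι : Type*} {n : ℕ} (A : Fin n → Matrix ι ι ℂ) :
    Matrix (Fin n → ι) (Fin n → ι) ℂ :=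
  Matrix.of fun f g => ∏ k, A k (f k) (g k)

/-- The state `ρ^{⊗ n}`. -/
def tensorPow {ι : Type*} (n : ℕ) (ρ : Matrix ι ι ℂ) : Matrix (Fin n → ι) (Fin n → ι) ℂ :=
  tensor fun _ => ρ

/-- The scaled sum `n^{-1/2} ∑_k I ⊗ ⋯ ⊗ A ⊗ ⋯ ⊗ I`, with `A` at the `k`-th place. -/
def iidSum {ι : Type*} [DecidableEq ι] (n : ℕ) (A : Matrix ι ι ℂ) :
    Matrix (Fin n → ι) (Fin n → ι) ℂ :=
  (((Real.sqrt n)⁻¹ : ℝ) : ℂ) •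
    ∑ k : Fin n, tensor (Function.update (fun _ => (1 : Matrix ι ι ℂ)) k A)

/-! ### Symmetric logarithmic derivatives and the commutation operator -/

/-- `L` is a list of symmetric logarithmic derivatives at `θ₀` of the family `θ ↦ ρ θ`:
`∂_i ρ = (ρ L_i + L_i ρ) / 2` at `θ₀`, with `L_i` selfadjoint. -/
def IsSLD {ι : Type*} [Fintype ι] {d : ℕ} (ρ : (Fin d → ℝ) → Matrix ι ι ℂ) (θ₀ : Fin d → ℝ)
    (L : Fin d → Matrix ι ι ℂ) : Prop :=
  ∀ i, (L i).IsHermitian ∧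
    HasDerivAt (fun t : ℝ => ρ (θ₀ + t • Pi.single i 1))
      ((1 / 2 : ℂ) • (ρ θ₀ * L i + L i * ρ θ₀)) 0

/-- The space `K_ρ = {K : K ρ = ρ K = 0}`, as a real subspace of the matrices. -/
def kerSpace {ι : Type*} [Fintype ι] (ρ : Matrix ι ι ℂ) : Submodule ℝ (Matrix ι ι ℂ) where
  carrier := {K | K * ρ = 0 ∧ ρ * K = 0}
  add_mem' := by
    rintro a b ⟨h1, h2⟩ ⟨h3, h4⟩
    exact ⟨by rw [Matrix.add_mul, h1, h3, add_zero], by rw [Matrix.mul_add, h2, h4, add_zero]⟩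
  zero_mem' := ⟨Matrix.zero_mul _, Matrix.mul_zero _⟩
  smul_mem' := by
    rintro c a ⟨h1, h2⟩
    exact ⟨by rw [Matrix.smul_mul, h1, smul_zero], by rw [Matrix.mul_smul, h2, smul_zero]⟩

/-- `Y` represents `𝒟_ρ X` modulo `K_ρ`, where
`𝒟_ρ = √-1 (L_ρ - R_ρ) / (L_ρ + R_ρ)` with `L_ρ Z = ρ Z` and `R_ρ Z = Z ρ`. The kernel of
`L_ρ + R_ρ` is `K_ρ`, so this equation determines the class of `Y` modulo `K_ρ`, which
depends only on the class of `X`. -/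
def RepresentsCommutation {ι : Type*} [Fintype ι] (ρ X Y : Matrix ι ι ℂ) : Prop :=
  ρ * Y + Y * ρ = Complex.I • (ρ * X - X * ρ)

/-- A real subspace `V` of matrices is `𝒟_ρ`-invariant if its image modulo `K_ρ` is mapped into
itself by `𝒟_ρ`. -/
def IsCommutationInvariant {ι : Type*} [Fintype ι] (ρ : Matrix ι ι ℂ)
    (V : Submodule ℝ (Matrix ι ι ℂ)) : Prop :=
  ∀ X ∈ V, ∃ Y ∈ V, RepresentsCommutation ρ X Y

/-- The list `X` of selfadjoint matrices is a `𝒟_ρ`-invariant extension of the list `L`. -/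
structure IsInvariantExtension {ι : Type*} [Fintype ι] {d r : ℕ} (ρ : Matrix ι ι ℂ)
    (X : Fin r → Matrix ι ι ℂ) (L : Fin d → Matrix ι ι ℂ) : Prop where
  isHermitian : ∀ i, (X i).IsHermitian
  span_le : Submodule.span ℝ (Set.range L) ≤ Submodule.span ℝ (Set.range X)
  invariant : IsCommutationInvariant ρ (Submodule.span ℝ (Set.range X))

/-- The matrix `Σ_{ij} = Tr ρ X_j X_i`. -/
def covMatrix {ι : Type*} [Fintype ι] {r : ℕ} (ρ : Matrix ι ι ℂ) (X : Fin r → Matrix ι ι ℂ) :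
    Matrix (Fin r) (Fin r) ℂ :=
  Matrix.of fun i j => (ρ * X j * X i).trace

/-- The matrix `A_{ij} = Tr √ρ X_i √ρ X_j`. -/
def crossCovMatrix {ι : Type*} [Fintype ι] [DecidableEq ι] {r : ℕ} (ρ : Matrix ι ι ℂ)
    (X : Fin r → Matrix ι ι ℂ) : Matrix (Fin r) (Fin r) ℂ :=
  Matrix.of fun i j => (msqrt ρ * X i * msqrt ρ * X j).trace

/-- `G` is the operator geometric mean `P # Q`, that is, the greatest element, in the Loewner
order, of the set of all `Z ≥ 0` for which the block matrix `[[P, Z], [Z, Q]]` is positive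
semidefinite. -/
structure IsGeometricMean {m : Type*} [Fintype m] (P Q G : Matrix m m ℂ) : Prop where
  posSemidef : G.PosSemidef
  block_posSemidef : (Matrix.fromBlocks P G G Q).PosSemidef
  greatest : ∀ Z : Matrix m m ℂ, Z.PosSemidef → (Matrix.fromBlocks P Z Z Q).PosSemidef →
    (G - Z).PosSemidef

/-! ### Convergence in distribution -/

/-- The quasi-characteristic function of the quantum Gaussian state `N(h, J)`, evaluated at
`(ξ_1, …, ξ_T)`. -/
def gaussianQuasiChar {r : ℕ} (h : Fin r → ℝ) (J : Matrix (Fin r) (Fin r) ℂ) {T : ℕ}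
    (ξ : Fin T → Fin r → ℝ) : ℂ :=
  Complex.exp
    ((∑ t, (Complex.I * (∑ i, (ξ t i : ℂ) * (h i : ℂ))
        - (1 / 2) * ∑ i, ∑ j, (ξ t i : ℂ) * (ξ t j : ℂ) * J j i))
      - ∑ t, ∑ u ∈ Finset.Ioi t, ∑ i, ∑ j, (ξ t i : ℂ) * (ξ u j : ℂ) * J j i)

/-- Quantum convergence in distribution of the observables `X n` under the states `ρ n` to
`N(h, J)`: convergence of all quasi-characteristic functions. -/
def ConvergesToGaussian {κ : ℕ → Type*} [∀ n, Fintype (κ n)] [∀ n, DecidableEq (κ n)] {r : ℕ}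
    (ρ : ∀ n, Matrix (κ n) (κ n) ℂ) (X : ∀ n, Fin r → Matrix (κ n) (κ n) ℂ)
    (h : Fin r → ℝ) (J : Matrix (Fin r) (Fin r) ℂ) : Prop :=
  ∀ (T : ℕ) (ξ : Fin T → Fin r → ℝ),
    Tendsto (fun n => (ρ n * (List.ofFn fun t => expI (lin (ξ t) (X n))).prod).trace) atTop
      (𝓝 (gaussianQuasiChar h J ξ))

/-! ### Quantum local asymptotic normality -/

/-- `R` is a square-root likelihood ratio of `σ` relative to `ρ`: `R ≥ 0` and
`σ = R ρ R + σ^⊥` with `σ^⊥ ≥ 0` and `Tr ρ σ^⊥ = 0`. -/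
def IsSqrtLikelihoodRatio {κ : Type*} [Fintype κ] (R σ ρ : Matrix κ κ ℂ) : Prop :=
  R.PosSemidef ∧ (σ - R * ρ * R).PosSemidef ∧ (ρ * (σ - R * ρ * R)).trace = 0

/-- `O n = o_{L²}(ρ n)`. -/
def IsLittleOL2 {κ : ℕ → Type*} [∀ n, Fintype (κ n)] (ρ O : ∀ n, Matrix (κ n) (κ n) ℂ) : Prop :=
  (∀ n, (O n).IsHermitian) ∧ Tendsto (fun n => (ρ n * (O n * O n)).trace) atTop (𝓝 0)

/-- `Z n = o_D(Y n, ρ n)`: the observables `Z n` are infinitesimal in distribution relative to the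
observables `Y n` under the states `ρ n`. -/
def IsLittleOD {κ : ℕ → Type*} [∀ n, Fintype (κ n)] [∀ n, DecidableEq (κ n)]
    (ρ Y Z : ∀ n, Matrix (κ n) (κ n) ℂ) : Prop :=
  (∀ n, (Z n).IsHermitian) ∧
  ∀ (T : ℕ) (ξ η : Fin T → ℝ),
    Tendsto (fun n =>
      (ρ n * (List.ofFn fun t => expI ((ξ t : ℂ) • Y n + (η t : ℂ) • Z n)).prod).trace
        - (ρ n * (List.ofFn fun t => expI ((ξ t : ℂ) • Y n)).prod).trace) atTop (𝓝 0)

/-- The sequence of models `{ρ n θ : θ ∈ Θ}` is quantum locally asymptotically normal at `θ₀`, with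
the observables `Δ n` and the matrix `J`. -/
structure IsQLAN {κ : ℕ → Type*} [∀ n, Fintype (κ n)] [∀ n, DecidableEq (κ n)] {d : ℕ}
    (Θ : Set (Fin d → ℝ)) (ρ : ∀ n, (Fin d → ℝ) → Matrix (κ n) (κ n) ℂ) (θ₀ : Fin d → ℝ)
    (Δ : ∀ n, Fin d → Matrix (κ n) (κ n) ℂ) (J : Matrix (Fin d) (Fin d) ℂ) : Prop where
  state : ∀ n, ∀ θ ∈ Θ, IsState (ρ n θ)
  isHermitian : ∀ n i, (Δ n i).IsHermitian
  posSemidef : J.PosSemidef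
  re_posDef : (rePart J).PosDef
  converges : ConvergesToGaussian (fun n => ρ n θ₀) Δ 0 J
  /-- `log (R_h + o_{L²})² = h^i Δ_i - (1/2) (h^i h^j J_{ij}) I + o_D(h^i Δ_i)`. -/
  expansion : ∀ h : Fin d → ℝ, ∃ R O Z : ∀ n, Matrix (κ n) (κ n) ℂ,
    (∀ᶠ n : ℕ in atTop, θ₀ + (Real.sqrt n)⁻¹ • h ∈ Θ ∧
      IsSqrtLikelihoodRatio (R n) (ρ n (θ₀ + (Real.sqrt n)⁻¹ • h)) (ρ n θ₀)) ∧
    IsLittleOL2 (fun n => ρ n θ₀) O ∧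
    IsLittleOD (fun n => ρ n θ₀) (fun n => lin h (Δ n)) Z ∧
    ∀ᶠ n in atTop, (R n + O n).PosDef ∧
      mlog ((R n + O n) ^ 2) =
        lin h (Δ n) - ((1 / 2 : ℂ) * (toC h ⬝ᵥ J.mulVec (toC h))) • 1 + Z n

/-! ### D-extensions -/

/-- The three conditions for the observables `X n` to be a D-extension of the observables `Δ n`
under the states `ρ n`, with coefficient matrix `F` and limiting covariance matrix `Sig`. -/
structure DExtensionConditions {κ : ℕ → Type*} [∀ n, Fintype (κ n)] [∀ n, DecidableEq (κ n)]
    {d r : ℕ} (ρ : ∀ n, Matrix (κ n) (κ n) ℂ) (Δ : ∀ n, Fin d → Matrix (κ n) (κ n) ℂ)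
    (X : ∀ n, Fin r → Matrix (κ n) (κ n) ℂ) (F : Matrix (Fin r) (Fin d) ℝ)
    (Sig : Matrix (Fin r) (Fin r) ℂ) : Prop where
  isHermitian : ∀ n i, (X n i).IsHermitian
  /-- `Δ_k = ∑_i F_k^i X_i`. -/
  eq_lin : ∀ n k, Δ n k = ∑ i, (F i k : ℂ) • X n i
  posSemidef : Sig.PosSemidef
  re_posDef : (rePart Sig).PosDef
  converges : ConvergesToGaussian ρ X 0 Sig
  /-- The sandwiched characteristic function converges to the Gaussian one with the blocks `Sig`,
  `Sig # Sigᵀ`, `Sig # Sigᵀ`, `Sigᵀ`. -/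
  sandwiched : ∃ G, IsGeometricMean Sig Sig.transpose G ∧
    ∀ ξ η : Fin r → ℝ,
      Tendsto (fun n => (msqrt (ρ n) * expI (lin ξ (X n)) * msqrt (ρ n) *
          expI (lin η (X n))).trace) atTop
        (𝓝 (Complex.exp (-(1 / 2) *
          (toC (Sum.elim ξ η) ⬝ᵥ
            (Matrix.fromBlocks Sig G G Sig.transpose).mulVec (toC (Sum.elim ξ η))))))

/-- The sequence of models `{ρ n θ : θ ∈ Θ}`, q-LAN at `θ₀` with the observables `Δ n`, is
D-extendible at `θ₀`. -/
def IsDExtendible {κ : ℕ → Type*} [∀ n, Fintype (κ n)] [∀ n, DecidableEq (κ n)] {d : ℕ}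
    (Θ : Set (Fin d → ℝ)) (ρ : ∀ n, (Fin d → ℝ) → Matrix (κ n) (κ n) ℂ) (θ₀ : Fin d → ℝ)
    (Δ : ∀ n, Fin d → Matrix (κ n) (κ n) ℂ) (J : Matrix (Fin d) (Fin d) ℂ) : Prop :=
  IsQLAN Θ ρ θ₀ Δ J ∧
  ∃ r : ℕ, d ≤ r ∧ ∃ (X : ∀ n, Fin r → Matrix (κ n) (κ n) ℂ) (F : Matrix (Fin r) (Fin d) ℝ)
    (Sig : Matrix (Fin r) (Fin r) ℂ), DExtensionConditions (fun n => ρ n θ₀) Δ X F Sig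

end QuantumIID

end

/-! The analytic part reduces to one copy. The summands of a scaled sum commute, so its exponential
is a tensor power, and so is the square root of `ρ^{⊗ n}`. Every trace in question is thus the
`n`-th power of a one-copy trace at `z = n^{-1/2}`. With centred observables that trace is `1 + c z²
+ o(z²)`, so the limit is `exp c`, where `c` is a quadratic form in `Σ` and, for the sandwiched
trace, also in `A` (`convergesToGaussian_iidSum`, `tendsto_sandwiched_iidSum`).

The algebraic part is `A = Σ # Σᵀ` (`isGeometricMean_crossCovMatrix`). The matrix `B = Σ + Σᵀ` is
positive definite, so some congruence `W` takes `B` to `1`, `Σ` to `diag α` and `Σᵀ` to `diag (1 -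
α)`. By `𝒟_ρ`-invariance the columns of `W` give combinations `Z` of the `X_i` with `ρ Z = α (ρ Z +
Z ρ)`, that is `(1 - α) ρ Z = α Z ρ`. This relation passes to square roots (`intertwine_sqrt`) and
yields `√ρ Z √ρ = √(α (1 - α)) (ρ Z + Z ρ)`, so `W` takes `A` to `diag √(α (1 - α))`. Maximality is
then a statement about diagonal matrices (`diagonal_sqrt_sub_posSemidef`).

Finally, q-LAN forces the `L_k` to be independent: a vanishing combination would have characteristic
function `1`, while the Gaussian limit has modulus less than `1`. -/

noncomputable section

namespace QuantumIID

open Matrix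

/-! ### Square roots of positive semidefinite matrices -/

section Sqrt

variable {κ : Type*} [Fintype κ] [DecidableEq κ]

open scoped MatrixOrder in
lemma msqrt_eq_sqrt {A : Matrix κ κ ℂ} (hA : A.PosSemidef) : msqrt A = CFC.sqrt A := by
  rw [msqrt, CFC.sqrt_eq_real_sqrt A hA.nonneg, cfcₙ_eq_cfc]

open scoped MatrixOrder in
lemma msqrt_posSemidef {A : Matrix κ κ ℂ} (hA : A.PosSemidef) : (msqrt A).PosSemidef := by
  rw [msqrt_eq_sqrt hA]
  exact (CFC.sqrt_nonneg A).posSemidef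

open scoped MatrixOrder in
lemma msqrt_mul_msqrt {A : Matrix κ κ ℂ} (hA : A.PosSemidef) : msqrt A * msqrt A = A := by
  rw [msqrt_eq_sqrt hA]
  exact CFC.sqrt_mul_sqrt_self A hA.nonneg

open scoped MatrixOrder in
lemma msqrt_unique {A B : Matrix κ κ ℂ} (hB : B.PosSemidef) (h : B * B = A) : msqrt A = B := by
  have hA : A.PosSemidef := by
    rw [← h]
    nth_rewrite 1 [← hB.isHermitian.eq]
    exact posSemidef_conjTranspose_mul_self B
  rw [msqrt_eq_sqrt hA]
  exact CFC.sqrt_unique h hB.nonneg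

/-- The trace is the squared Hilbert–Schmidt norm of `√s E`. -/
lemma mul_eq_zero_of_trace_eq_zero {s E : Matrix κ κ ℂ} (hs : s.PosSemidef)
    (h : (Eᴴ * s * E).trace = 0) : s * E = 0 := by
  have ht := msqrt_mul_msqrt hs
  have hth := (msqrt_posSemidef hs).isHermitian.eq
  have h1 : (msqrt s * E)ᴴ * (msqrt s * E) = Eᴴ * s * E := by
    rw [conjTranspose_mul, hth]
    nth_rewrite 3 [← ht]
    simp only [Matrix.mul_assoc]
  rw [← h1, trace_conjTranspose_mul_self_eq_zero_iff] at h
  rw [← ht, Matrix.mul_assoc, h, Matrix.mul_zero]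

/-- The intertwining relation `p² s² Z = q² Z s²` passes to square roots. -/
lemma intertwine_sqrt {s Z : Matrix κ κ ℂ} (hs : s.PosSemidef) {p q : ℝ} (hp : 0 ≤ p) (hq : 0 ≤ q)
    (h : ((p ^ 2 : ℝ) : ℂ) • (s * s * Z) = ((q ^ 2 : ℝ) : ℂ) • (Z * (s * s))) :
    (p : ℂ) • (s * Z) = (q : ℂ) • (Z * s) := by
  set E := (p : ℂ) • (s * Z) - (q : ℂ) • (Z * s) with hE
  -- The mixed terms `p q s Z s` cancel, so the hypothesis becomes a Sylvester equation for the
  -- defect `E`.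
  have hsyl : (p : ℂ) • (s * E) + (q : ℂ) • (E * s) = 0 := by
    have : (p : ℂ) • (s * E) + (q : ℂ) • (E * s)
        = ((p ^ 2 : ℝ) : ℂ) • (s * s * Z) - ((q ^ 2 : ℝ) : ℂ) • (Z * (s * s)) := by
      simp only [hE, Matrix.mul_sub, Matrix.sub_mul, Matrix.mul_smul, Matrix.smul_mul, smul_sub,
        smul_smul, Matrix.mul_assoc]
      push_cast
      rw [mul_comm (q : ℂ) (p : ℂ), pow_two, pow_two]
      abel
    rw [this, h, sub_self]
  have hps : ((p : ℂ) • s).PosSemidef := hs.smul (by exact_mod_cast hp)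
  have hqs : ((q : ℂ) • s).PosSemidef := hs.smul (by exact_mod_cast hq)
  -- Pairing the Sylvester equation with `Eᴴ` gives two nonnegative traces with sum zero. Both
  -- vanish, which suffices for `E = 0` even when `s` is singular or `p q = 0`.
  have h1 : 0 ≤ (Eᴴ * ((p : ℂ) • s) * E).trace := (hps.conjTranspose_mul_mul_same E).trace_nonneg
  have h2 : 0 ≤ (Eᴴᴴ * ((q : ℂ) • s) * Eᴴ).trace :=
    (hqs.conjTranspose_mul_mul_same Eᴴ).trace_nonneg
  have h3 : (Eᴴ * ((p : ℂ) • s) * E).trace + (Eᴴᴴ * ((q : ℂ) • s) * Eᴴ).trace = 0 := by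
    have h4 := congrArg (fun M => (Eᴴ * M).trace) hsyl
    simp only [Matrix.mul_add, trace_add, Matrix.mul_zero, trace_zero] at h4
    rw [← h4, conjTranspose_conjTranspose, trace_mul_comm (E * _)]
    simp only [Matrix.mul_smul, Matrix.smul_mul, Matrix.mul_assoc]
  obtain ⟨h5, h6⟩ := (add_eq_zero_iff_of_nonneg h1 h2).1 h3
  have h7 := mul_eq_zero_of_trace_eq_zero hps h5
  have h8 := mul_eq_zero_of_trace_eq_zero hqs h6
  have h9 : Eᴴ * ((p : ℂ) • s) = 0 := by
    have := congrArg conjTranspose h7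
    rwa [conjTranspose_mul, hps.isHermitian.eq, conjTranspose_zero] at this
  have h10 : (Eᴴ * E).trace = 0 := by
    rw [congrArg (fun M => (Eᴴ * M).trace) hE, Matrix.mul_sub, trace_sub, ← Matrix.smul_mul,
      ← Matrix.mul_smul, ← Matrix.mul_assoc, h9, ← Matrix.mul_assoc, trace_mul_comm (Eᴴ * Z),
      ← Matrix.mul_assoc, h8]
    simp
  exact sub_eq_zero.1 (trace_conjTranspose_mul_self_eq_zero_iff.1 h10)

/-- If `ρ Z = α (ρ Z + Z ρ)`, then `√ρ Z √ρ = √(α (1 - α)) (ρ Z + Z ρ)`. -/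
lemma sandwich_of_eigen {s Z : Matrix κ κ ℂ} (hs : s.PosSemidef) {α : ℝ} (h0 : 0 ≤ α) (h1 : α ≤ 1)
    (h : s * s * Z = (α : ℂ) • (s * s * Z + Z * (s * s))) :
    s * Z * s = ((Real.sqrt (α * (1 - α)) : ℝ) : ℂ) • (s * s * Z + Z * (s * s)) := by
  have hp : Real.sqrt (1 - α) ^ 2 = 1 - α := Real.sq_sqrt (by linarith)
  have hq : Real.sqrt α ^ 2 = α := Real.sq_sqrt h0
  -- The hypothesis reads `(1 - α) s² Z = α Z s²`, whence `p = √(1 - α)` and `q = √α`. Below, `q p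
  -- s² Z = q² s Z s` and `q p Z s² = p² s Z s`, and `p² + q² = 1`.
  have key := intertwine_sqrt (s := s) (Z := Z) hs (Real.sqrt_nonneg (1 - α)) (Real.sqrt_nonneg α)
    (by
      rw [hp, hq]
      push_cast
      rw [sub_smul, one_smul]
      nth_rewrite 1 [h]
      rw [smul_add]
      abel)
  rw [Real.sqrt_mul h0]
  set p := Real.sqrt (1 - α)
  set q := Real.sqrt α
  have e1 : ((q * p : ℝ) : ℂ) • (s * s * Z) = ((q ^ 2 : ℝ) : ℂ) • (s * Z * s) := by
    have : ((q * p : ℝ) : ℂ) • (s * s * Z) = (q : ℂ) • (s * ((p : ℂ) • (s * Z))) := by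
      rw [Matrix.mul_smul, smul_smul, Matrix.mul_assoc]
      push_cast
      rfl
    rw [this, key, Matrix.mul_smul, smul_smul, Matrix.mul_assoc, pow_two]
    push_cast
    rfl
  have e2 : ((q * p : ℝ) : ℂ) • (Z * (s * s)) = ((p ^ 2 : ℝ) : ℂ) • (s * Z * s) := by
    have : ((q * p : ℝ) : ℂ) • (Z * (s * s)) = (p : ℂ) • (((q : ℂ) • (Z * s)) * s) := by
      rw [Matrix.smul_mul, smul_smul, Matrix.mul_assoc, mul_comm]
      push_cast
      rfl
    rw [this, ← key, Matrix.smul_mul, smul_smul, pow_two]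
    push_cast
    rfl
  rw [smul_add, e1, e2, ← add_smul, hp, hq]
  simp

end Sqrt

/-! ### The geometric mean of two commuting matrices -/

section GeometricMean

variable {m : Type*} [Fintype m] [DecidableEq m]

/-- A positive definite and a Hermitian matrix are simultaneously diagonalized by a congruence. -/
lemma exists_simultaneous_diagonalization {B S : Matrix m m ℂ} (hB : B.PosDef)
    (hS : S.IsHermitian) :
    ∃ (W : Matrix m m ℂ) (α : m → ℝ), IsUnit W ∧ Wᴴ * B * W = 1 ∧
      Wᴴ * S * W = diagonal fun k => (α k : ℂ) := by
  have hs := msqrt_mul_msqrt hB.posSemidef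
  have hsh := (msqrt_posSemidef hB.posSemidef).isHermitian
  set s := msqrt B
  have hsu : IsUnit s := by
    rw [Matrix.isUnit_iff_isUnit_det]
    have : IsUnit (s * s).det := by
      rw [hs]
      exact (Matrix.isUnit_iff_isUnit_det _).1 hB.isUnit
    rw [det_mul] at this
    exact isUnit_of_mul_isUnit_left this
  have hsd := (Matrix.isUnit_iff_isUnit_det _).1 hsu
  have hih : (s⁻¹)ᴴ = s⁻¹ := hsh.inv.eq
  have hN : (s⁻¹ * S * s⁻¹).IsHermitian := by
    rw [IsHermitian, conjTranspose_mul, conjTranspose_mul, hih, hS.eq, Matrix.mul_assoc]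
  set U : Matrix m m ℂ := (hN.eigenvectorUnitary : Matrix m m ℂ) with hU
  have hUU : Uᴴ * U = 1 := Unitary.coe_star_mul_self hN.eigenvectorUnitary
  have hspec : s⁻¹ * S * s⁻¹ = U * diagonal (fun k => (hN.eigenvalues k : ℂ)) * Uᴴ := by
    have := hN.spectral_theorem
    rw [Unitary.conjStarAlgAut_apply] at this
    exact this
  -- `W = B^{-1/2} U`, where `U` diagonalizes `B^{-1/2} S B^{-1/2}`.
  refine ⟨s⁻¹ * U, hN.eigenvalues, ?_, ?_, ?_⟩
  · exact ((Matrix.isUnit_nonsing_inv_iff).2 hsu).mul (Unitary.isUnit_coe)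
  · rw [conjTranspose_mul, hih]
    calc Uᴴ * s⁻¹ * B * (s⁻¹ * U) = Uᴴ * (s⁻¹ * s) * (s * s⁻¹) * U := by
          rw [← hs]; simp only [Matrix.mul_assoc]
      _ = 1 := by
          rw [Matrix.nonsing_inv_mul _ hsd, Matrix.mul_nonsing_inv _ hsd, Matrix.mul_one,
            Matrix.mul_one, hUU]
  · rw [conjTranspose_mul, hih]
    calc Uᴴ * s⁻¹ * S * (s⁻¹ * U) = Uᴴ * (s⁻¹ * S * s⁻¹) * U := by simp only [Matrix.mul_assoc]
      _ = (Uᴴ * U) * diagonal (fun k => (hN.eigenvalues k : ℂ)) * (Uᴴ * U) :=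
          (congrArg (fun M => Uᴴ * M * U) hspec).trans (by simp only [Matrix.mul_assoc])
      _ = _ := by rw [hUU, Matrix.one_mul, Matrix.mul_one]

/-- An eigenvector `x` for an eigenvalue `-l < 0` would satisfy `(M x)_k = (g_k + l) x_k` with `g =
√(a b)`. On the vector `(-c x, x)` the block form then becomes a weighted sum of `|x_k|²`, and `c`
can be chosen to make every weight negative. -/
lemma diagonal_sqrt_sub_posSemidef {a b : m → ℝ} (ha : ∀ k, 0 ≤ a k) (hb : ∀ k, 0 ≤ b k)
    (hab : ∀ k, 0 < a k + b k) {M : Matrix m m ℂ} (hM : M.IsHermitian)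
    (h : (fromBlocks (diagonal fun k => (a k : ℂ)) M M
      (diagonal fun k => (b k : ℂ))).PosSemidef) :
    ((diagonal fun k => ((Real.sqrt (a k * b k) : ℝ) : ℂ)) - M).PosSemidef := by
  set g : m → ℝ := fun k => Real.sqrt (a k * b k) with hg
  have hg0 : ∀ k, 0 ≤ g k := fun k => Real.sqrt_nonneg _
  have hg2 : ∀ k, g k ^ 2 = a k * b k := fun k => Real.sq_sqrt (mul_nonneg (ha k) (hb k))
  have hN : ((diagonal fun k => (g k : ℂ)) - M).IsHermitian := by
    refine IsHermitian.sub ?_ hM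
    rw [IsHermitian, diagonal_conjTranspose]
    congr 1
    ext k
    simp
  rw [hN.posSemidef_iff_eigenvalues_nonneg]
  intro i
  by_contra hneg
  obtain ⟨l, hl, hli⟩ : ∃ l : ℝ, 0 < l ∧ hN.eigenvalues i = -l :=
    ⟨-hN.eigenvalues i, by simpa using hneg, by simp⟩
  set x : m → ℂ := (hN.eigenvectorBasis i).ofLp with hx
  have hx0 : x ≠ 0 := by
    intro h0
    have := (hN.eigenvectorBasis.orthonormal.ne_zero i)
    apply this
    ext k
    exact congrFun h0 k
  have hev := hN.mulVec_eigenvectorBasis i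
  have hMx : ∀ k, (M *ᵥ x) k = ((g k + l : ℝ) : ℂ) * x k := by
    intro k
    have := congrFun hev k
    rw [sub_mulVec, Pi.sub_apply, mulVec_diagonal, hli] at this
    simp only [Pi.smul_apply, Complex.real_smul] at this
    change (g k : ℂ) * x k - (M *ᵥ x) k = _ * x k at this
    push_cast at this ⊢
    linear_combination -this
  -- For `a_k > 0` this minimizes the weight `a c² - 2 c (g + l) + b`, with minimum `-(2 g l + l²) /
  -- a`. For `a_k = 0` also `g_k = 0`, the weight is linear in `c`, and its value is `-b_k`,
  -- negative by `hab`.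
  set c : m → ℝ := fun k => if a k = 0 then b k / l else (g k + l) / a k with hc
  have hq := h.dotProduct_mulVec_nonneg (Sum.elim (fun k => -((c k : ℂ) * x k)) x)
  have hform : star (Sum.elim (fun k => -((c k : ℂ) * x k)) x) ⬝ᵥ
      (fromBlocks (diagonal fun k => (a k : ℂ)) M M (diagonal fun k => (b k : ℂ))) *ᵥ
        (Sum.elim (fun k => -((c k : ℂ) * x k)) x)
      = ((∑ k, (a k * c k ^ 2 - 2 * c k * (g k + l) + b k) * Complex.normSq (x k) : ℝ) : ℂ) := by
    have hsymm : star x ⬝ᵥ M *ᵥ (fun k => -((c k : ℂ) * x k))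
        = star (M *ᵥ x) ⬝ᵥ (fun k => -((c k : ℂ) * x k)) := by
      rw [dotProduct_mulVec, star_mulVec, hM.eq]
    rw [fromBlocks_mulVec]
    have hstar : star (Sum.elim (fun k => -((c k : ℂ) * x k)) x)
        = Sum.elim (star fun k => -((c k : ℂ) * x k)) (star x) := by
      ext k; cases k <;> rfl
    rw [hstar, sumElim_dotProduct_sumElim]
    simp only [Sum.elim_comp_inl, Sum.elim_comp_inr]
    rw [dotProduct_add, dotProduct_add, hsymm]
    simp only [dotProduct, ← Finset.sum_add_distrib, Complex.ofReal_sum]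
    refine Finset.sum_congr rfl fun k _ => ?_
    simp only [Pi.star_apply, mulVec_diagonal, hMx]
    simp only [RCLike.star_def, map_neg, map_mul, Complex.conj_ofReal]
    push_cast
    rw [Complex.normSq_eq_conj_mul_self]
    ring
  rw [hform] at hq
  have hq' : 0 ≤ ∑ k, (a k * c k ^ 2 - 2 * c k * (g k + l) + b k) * Complex.normSq (x k) := by
    exact_mod_cast hq
  have hcoef : ∀ k, a k * c k ^ 2 - 2 * c k * (g k + l) + b k < 0 := by
    intro k
    by_cases hak : a k = 0
    · have hgk : g k = 0 := by
        have := hg2 k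
        rw [hak, zero_mul] at this
        exact pow_eq_zero_iff two_ne_zero |>.1 this
      have hbk : 0 < b k := by have := hab k; rwa [hak, zero_add] at this
      have : c k * l = b k := by
        have : c k = b k / l := by simp [hc, hak]
        rw [this, div_mul_cancel₀ _ hl.ne']
      rw [hak, hgk]
      linarith
    · have hak' : 0 < a k := lt_of_le_of_ne (ha k) (Ne.symm hak)
      have : c k = (g k + l) / a k := by simp [hc, hak]
      have e : a k * c k ^ 2 - 2 * c k * (g k + l) + b k = -((2 * g k * l + l ^ 2) / a k) := by
        rw [this]
        field_simp
        linear_combination (-1 : ℝ) * hg2 k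
      rw [e, neg_lt_zero]
      have := hg0 k
      positivity
  obtain ⟨k₀, hk₀⟩ : ∃ k, x k ≠ 0 := by
    by_contra hall
    push Not at hall
    exact hx0 (funext hall)
  have : ∑ k, (a k * c k ^ 2 - 2 * c k * (g k + l) + b k) * Complex.normSq (x k) < 0 := by
    refine Finset.sum_neg' (fun k _ => ?_) ⟨k₀, Finset.mem_univ _, ?_⟩
    · exact mul_nonpos_of_nonpos_of_nonneg (hcoef k).le (Complex.normSq_nonneg _)
    · exact mul_neg_of_neg_of_pos (hcoef k₀) (Complex.normSq_pos.2 hk₀)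
  linarith

/-- If a congruence `W` diagonalizes `P`, `Q` and `G` to `a`, `b` and `√(a b)`, then every `M` with
`[[P, M], [M, Q]] ≥ 0` satisfies `M ≤ G`. -/
lemma sub_posSemidef_of_congruence {P Q G W : Matrix m m ℂ} {a b : m → ℝ} (hW : IsUnit W)
    (ha : ∀ k, 0 ≤ a k) (hb : ∀ k, 0 ≤ b k) (hab : ∀ k, 0 < a k + b k)
    (hP : Wᴴ * P * W = diagonal fun k => (a k : ℂ)) (hQ : Wᴴ * Q * W = diagonal fun k => (b k : ℂ))
    (hG : Wᴴ * G * W = diagonal fun k => ((Real.sqrt (a k * b k) : ℝ) : ℂ))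
    {M : Matrix m m ℂ} (hM : M.IsHermitian) (h : (fromBlocks P M M Q).PosSemidef) :
    (G - M).PosSemidef := by
  rw [← Matrix.IsUnit.posSemidef_star_left_conjugate_iff hW, star_eq_conjTranspose, Matrix.mul_sub,
    Matrix.sub_mul, hG]
  refine diagonal_sqrt_sub_posSemidef ha hb hab ?_ ?_
  · rw [IsHermitian, conjTranspose_mul, conjTranspose_mul, conjTranspose_conjTranspose, hM.eq,
      Matrix.mul_assoc]
  · have := h.conjTranspose_mul_mul_same (fromBlocks W 0 0 W)
    rw [fromBlocks_conjTranspose, fromBlocks_multiply, fromBlocks_multiply] at this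
    simpa [hP, hQ] using this

end GeometricMean

/-! ### Covariance matrices as Gram matrices -/

section Gram

variable {ι : Type*}

/-- The Gram matrix of a family of matrices, with respect to the Hilbert–Schmidt inner product, is
positive semidefinite. -/
lemma posSemidef_gram [Fintype ι] {m : Type*} [Fintype m] (E : m → Matrix ι ι ℂ) :
    (Matrix.of fun p q => ((E p)ᴴ * E q).trace).PosSemidef := by
  convert! posSemidef_conjTranspose_mul_self (Matrix.of fun (x : ι × ι) q => E q x.1 x.2) using 1
  ext p q
  simp only [of_apply, trace, diag_apply, mul_apply, conjTranspose_apply, Fintype.sum_prod_type]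
  exact Finset.sum_comm

variable {r : ℕ} {ρ : Matrix ι ι ℂ} {X : Fin r → Matrix ι ι ℂ}

/-- The linear combination `z^i X_i` with complex coefficients. -/
def comb (z : Fin r → ℂ) (X : Fin r → Matrix ι ι ℂ) : Matrix ι ι ℂ := ∑ i, z i • X i

lemma lin_isHermitian (hX : ∀ i, (X i).IsHermitian)
    (ξ : Fin r → ℝ) : (lin ξ X).IsHermitian := by
  rw [IsHermitian, lin, conjTranspose_sum]
  refine Finset.sum_congr rfl fun i _ => ?_
  rw [conjTranspose_smul, (hX i).eq]
  simp

lemma lin_eq_sum_smul (X : Fin r → Matrix ι ι ℂ) (ξ : Fin r → ℝ) :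
    lin ξ X = ∑ i, ξ i • X i :=
  Finset.sum_congr rfl fun i _ => by ext; simp

lemma comb_eq_lin_add (z : Fin r → ℂ) :
    comb z X = lin (fun i => (z i).re) X + Complex.I • lin (fun i => (z i).im) X := by
  simp only [comb, lin, Finset.smul_sum, ← Finset.sum_add_distrib, smul_smul, ← add_smul]
  refine Finset.sum_congr rfl fun i _ => ?_
  rw [mul_comm Complex.I, Complex.re_add_im]

lemma conjTranspose_comb (hX : ∀ i, (X i).IsHermitian) (z : Fin r → ℂ) :
    (comb z X)ᴴ = ∑ i, star (z i) • X i := by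
  rw [comb, conjTranspose_sum]
  refine Finset.sum_congr rfl fun i _ => ?_
  rw [conjTranspose_smul, (hX i).eq]

variable [Fintype ι]

lemma trace_lin_mul_lin (ξ η : Fin r → ℝ) (M N : Matrix ι ι ℂ) :
    (M * lin ξ X * N * lin η X).trace
      = ∑ i, ∑ j, (ξ i : ℂ) * (η j : ℂ) * (M * X i * N * X j).trace := by
  simp only [lin, Matrix.sum_mul, trace_sum, Matrix.mul_smul, Matrix.smul_mul,
    trace_smul, smul_eq_mul, Finset.mul_sum]
  rw [Finset.sum_comm]
  refine Finset.sum_congr rfl fun i _ => Finset.sum_congr rfl fun j _ => ?_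
  ring

/-- With `X i` in front, `Σ`, `Σᵀ`, their sum and `A` pair `X i` with `ρ X_j`, `X_j ρ`, `ρ X_j + X_j
ρ` and `√ρ X_j √ρ`. Operator identities for the `X_j` thereby turn into matrix identities. -/
lemma covMatrix_apply (i j : Fin r) : covMatrix ρ X i j = (X i * (ρ * X j)).trace :=
  trace_mul_comm _ _

lemma covMatrix_transpose_apply (i j : Fin r) :
    (covMatrix ρ X)ᵀ i j = (X i * (X j * ρ)).trace := by
  change (ρ * X i * X j).trace = _
  rw [Matrix.mul_assoc, trace_mul_comm, Matrix.mul_assoc]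

lemma covMatrix_add_transpose_apply (i j : Fin r) :
    (covMatrix ρ X + (covMatrix ρ X)ᵀ) i j = (X i * (ρ * X j + X j * ρ)).trace := by
  rw [Matrix.add_apply, covMatrix_apply, covMatrix_transpose_apply, Matrix.mul_add, trace_add]

lemma eq_zero_of_lin_mem_kerSpace (hX : LinearIndependent ℝ fun i => (kerSpace ρ).mkQ (X i))
    {ξ : Fin r → ℝ} (h : lin ξ X ∈ kerSpace ρ) : ξ = 0 := by
  funext i
  refine Fintype.linearIndependent_iff.1 hX ξ ?_ i
  simp only [← map_smul]
  rw [← map_sum, ← lin_eq_sum_smul]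
  exact (Submodule.Quotient.mk_eq_zero _).2 h

/-- Independence is assumed only over `ℝ`, so the combination is split into its selfadjoint and skew
parts. Placing both in `K_ρ` requires the conditions on the adjoint as well. -/
lemma comb_eq_zero (hXh : ∀ i, (X i).IsHermitian)
    (hX : LinearIndependent ℝ fun i => (kerSpace ρ).mkQ (X i)) {z : Fin r → ℂ}
    (h1 : ρ * comb z X = 0) (h2 : comb z X * ρ = 0) (h3 : ρ * (comb z X)ᴴ = 0)
    (h4 : (comb z X)ᴴ * ρ = 0) : z = 0 := by
  have hconj : (comb z X)ᴴ
      = lin (fun i => (z i).re) X - Complex.I • lin (fun i => (z i).im) X := by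
    rw [comb_eq_lin_add, conjTranspose_add, conjTranspose_smul, (lin_isHermitian hXh _).eq,
      (lin_isHermitian hXh _).eq]
    simp [sub_eq_add_neg]
  set P := lin (fun i => (z i).re) X
  set Q := lin (fun i => (z i).im) X
  have hP : P = (1 / 2 : ℂ) • (comb z X + (comb z X)ᴴ) := by
    rw [hconj, comb_eq_lin_add]
    module
  have hQ : Q = (-(Complex.I) / 2 : ℂ) • (comb z X - (comb z X)ᴴ) := by
    rw [hconj, comb_eq_lin_add]
    have : (P + Complex.I • Q) - (P - Complex.I • Q) = (2 * Complex.I) • Q := by module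
    change Q = _ • ((P + Complex.I • Q) - (P - Complex.I • Q))
    rw [this, smul_smul]
    have : -Complex.I / 2 * (2 * Complex.I) = 1 := by
      linear_combination -Complex.I_mul_I
    rw [this, one_smul]
  have hPk : P ∈ kerSpace ρ := by
    constructor
    · rw [hP, Matrix.smul_mul, Matrix.add_mul, h2, h4]; simp
    · rw [hP, Matrix.mul_smul, Matrix.mul_add, h1, h3]; simp
  have hQk : Q ∈ kerSpace ρ := by
    constructor
    · rw [hQ, Matrix.smul_mul, Matrix.sub_mul, h2, h4]; simp
    · rw [hQ, Matrix.mul_smul, Matrix.mul_sub, h1, h3]; simp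
  funext i
  exact Complex.ext (congrFun (eq_zero_of_lin_mem_kerSpace hX hPk) i)
    (congrFun (eq_zero_of_lin_mem_kerSpace hX hQk) i)

/-- In coordinates with respect to `X`, the operator `L_ρ / (L_ρ + R_ρ)` is given by a matrix. -/
lemma exists_commutation_coeff
    (hinv : IsCommutationInvariant ρ (Submodule.span ℝ (Set.range X))) :
    ∃ a : Matrix (Fin r) (Fin r) ℂ, ∀ j, ρ * X j = ∑ i, a i j • (ρ * X i + X i * ρ) := by
  have h : ∀ j, ∃ c : Fin r → ℝ, RepresentsCommutation ρ (X j) (lin c X) := by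
    intro j
    obtain ⟨Y, hY, hYr⟩ := hinv (X j) (Submodule.subset_span ⟨j, rfl⟩)
    obtain ⟨c, hc⟩ := (Submodule.mem_span_range_iff_exists_fun ℝ).1 hY
    exact ⟨c, by rwa [lin_eq_sum_smul, hc]⟩
  choose c hc using h
  -- If `Y` represents `𝒟_ρ X`, then `ρ X - X ρ = -√-1 (ρ Y + Y ρ)`. Averaging with `ρ X + X ρ`
  -- gives `a = (1 - √-1 c) / 2`.
  refine ⟨Matrix.of fun i j => (1 / 2 : ℂ) * ((if i = j then 1 else 0) - Complex.I * (c j i : ℂ)),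
    fun j => ?_⟩
  have hcj := hc j
  rw [RepresentsCommutation] at hcj
  have e1 : ∑ i, (c j i : ℂ) • (ρ * X i + X i * ρ) = Complex.I • (ρ * X j - X j * ρ) := by
    rw [← hcj, lin, Matrix.mul_sum, Matrix.sum_mul, ← Finset.sum_add_distrib]
    refine Finset.sum_congr rfl fun i _ => ?_
    rw [smul_add, Matrix.mul_smul, Matrix.smul_mul]
  have e2 : ∑ i, (if i = j then (1 : ℂ) else 0) • (ρ * X i + X i * ρ) = ρ * X j + X j * ρ := by
    simp only [ite_smul, one_smul, zero_smul, Finset.sum_ite_eq', Finset.mem_univ, if_true]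
  simp only [of_apply]
  simp only [mul_smul, sub_smul, ← Finset.smul_sum, Finset.sum_sub_distrib, e1, e2]
  rw [smul_smul, Complex.I_mul_I]
  module

variable [DecidableEq ι]

lemma crossCovMatrix_apply (i j : Fin r) :
    crossCovMatrix ρ X i j = (X i * (msqrt ρ * X j * msqrt ρ)).trace := by
  change (msqrt ρ * X i * msqrt ρ * X j).trace = _
  simp only [Matrix.mul_assoc]
  rw [trace_mul_comm]
  simp only [Matrix.mul_assoc]

/-- This is the Gram matrix of the operators `√ρ X_i` and `X_i √ρ`. -/
lemma posSemidef_fromBlocks_covMatrix (hρ : ρ.PosSemidef) (hX : ∀ i, (X i).IsHermitian) :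
    (fromBlocks (covMatrix ρ X) (crossCovMatrix ρ X) (crossCovMatrix ρ X)
      (covMatrix ρ X)ᵀ).PosSemidef := by
  have hs := msqrt_mul_msqrt hρ
  have hh := (msqrt_posSemidef hρ).isHermitian.eq
  convert! posSemidef_gram (Sum.elim (fun i => msqrt ρ * X i) fun i => X i * msqrt ρ) using 1
  ext (i | i) (j | j)
  · simp only [fromBlocks_apply₁₁, of_apply, Sum.elim_inl, conjTranspose_mul, hh, (hX i).eq,
      covMatrix_apply]
    conv_lhs => rw [← hs]
    simp only [Matrix.mul_assoc]
  · simp only [fromBlocks_apply₁₂, of_apply, Sum.elim_inl, Sum.elim_inr, conjTranspose_mul, hh,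
      (hX i).eq, crossCovMatrix_apply]
    simp only [Matrix.mul_assoc]
  · simp only [fromBlocks_apply₂₁, of_apply, Sum.elim_inl, Sum.elim_inr, conjTranspose_mul, hh,
      (hX i).eq, crossCovMatrix, Matrix.mul_assoc]
  · simp only [fromBlocks_apply₂₂, of_apply, Sum.elim_inr, conjTranspose_mul, hh, (hX i).eq,
      covMatrix_transpose_apply]
    conv_lhs => rw [← hs]
    simp only [Matrix.mul_assoc]
    rw [trace_mul_comm (msqrt ρ)]
    simp only [Matrix.mul_assoc]

lemma covMatrix_posSemidef (hρ : ρ.PosSemidef) (hX : ∀ i, (X i).IsHermitian) :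
    (covMatrix ρ X).PosSemidef :=
  (posSemidef_fromBlocks_covMatrix hρ hX).submatrix Sum.inl

/-- This is the Gram matrix of the operators `ρ^{1/4} X_i ρ^{1/4}`. -/
lemma crossCovMatrix_posSemidef (hρ : ρ.PosSemidef) (hX : ∀ i, (X i).IsHermitian) :
    (crossCovMatrix ρ X).PosSemidef := by
  have hps := msqrt_posSemidef hρ
  have ht := msqrt_mul_msqrt hps
  have hth := (msqrt_posSemidef hps).isHermitian.eq
  convert! posSemidef_gram (fun i => msqrt (msqrt ρ) * X i * msqrt (msqrt ρ)) using 1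
  ext i j
  rw [crossCovMatrix_apply, of_apply, conjTranspose_mul, conjTranspose_mul, hth, (hX i).eq]
  conv_lhs => rw [← ht]
  simp only [Matrix.mul_assoc]
  conv_rhs => rw [trace_mul_comm]
  simp only [Matrix.mul_assoc]

/-- With `Z = z^i X_i` the form at `z` is `Tr Zᴴ ρ Z + Tr Z ρ Zᴴ`. Its vanishing forces `ρ Z = 0`
and `ρ Zᴴ = 0`, and taking adjoints `Zᴴ ρ = 0` and `Z ρ = 0`. -/
lemma covMatrix_add_transpose_posDef (hρ : ρ.PosSemidef) (hXh : ∀ i, (X i).IsHermitian)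
    (hX : LinearIndependent ℝ fun i => (kerSpace ρ).mkQ (X i)) :
    (covMatrix ρ X + (covMatrix ρ X)ᵀ).PosDef := by
  have hS := covMatrix_posSemidef hρ hXh
  have hB := hS.add hS.transpose
  refine PosDef.of_dotProduct_mulVec_pos hB.isHermitian fun z hz => ?_
  refine lt_of_le_of_ne (hB.dotProduct_mulVec_nonneg z) fun h0 => hz ?_
  have hform : star z ⬝ᵥ (covMatrix ρ X + (covMatrix ρ X)ᵀ) *ᵥ z
      = ((comb z X)ᴴ * ρ * comb z X).trace + ((comb z X)ᴴᴴ * ρ * (comb z X)ᴴ).trace := by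
    rw [conjTranspose_conjTranspose, trace_mul_comm _ (comb z X)ᴴ, Matrix.mul_assoc, ← trace_add,
      ← Matrix.mul_add, conjTranspose_comb hXh]
    simp only [dotProduct, mulVec, covMatrix_add_transpose_apply, comb,
      Matrix.sum_mul, Matrix.mul_add, Matrix.mul_smul, Matrix.smul_mul, trace_add, trace_sum,
      trace_smul, ← Finset.sum_add_distrib, Finset.mul_sum, smul_eq_mul, Pi.star_apply]
    rw [Finset.sum_comm]
    refine Finset.sum_congr rfl fun i _ => Finset.sum_congr rfl fun j _ => ?_
    ring
  rw [hform] at h0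
  obtain ⟨h1, h2⟩ := (add_eq_zero_iff_of_nonneg
    (hρ.conjTranspose_mul_mul_same (comb z X)).trace_nonneg
    (hρ.conjTranspose_mul_mul_same (comb z X)ᴴ).trace_nonneg).1 h0.symm
  have h3 := mul_eq_zero_of_trace_eq_zero hρ h1
  have h4 := mul_eq_zero_of_trace_eq_zero hρ h2
  refine comb_eq_zero hXh hX h3 ?_ h4 ?_
  · simpa [conjTranspose_mul, hρ.isHermitian.eq] using congrArg conjTranspose h4
  · simpa [conjTranspose_mul, hρ.isHermitian.eq] using congrArg conjTranspose h3

/-- As `Σ` is Hermitian, `Re Σ` is half of `Σ + Σᵀ`. -/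
lemma rePart_covMatrix_posDef (hρ : ρ.PosSemidef) (hXh : ∀ i, (X i).IsHermitian)
    (hX : LinearIndependent ℝ fun i => (kerSpace ρ).mkQ (X i)) :
    (rePart (covMatrix ρ X)).PosDef := by
  have hS := covMatrix_posSemidef hρ hXh
  have hB := covMatrix_add_transpose_posDef hρ hXh hX
  have hconj : ∀ i j, covMatrix ρ X j i = star (covMatrix ρ X i j) := fun i j => by
    have := congrFun (congrFun hS.isHermitian.eq j) i
    rw [conjTranspose_apply] at this
    exact this.symm
  refine PosDef.of_dotProduct_mulVec_pos ?_ fun x hx => ?_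
  · ext i j
    simp [rePart, hconj i j]
  · have hz : toC x ≠ 0 := fun h => hx (funext fun i => by
      have := congrFun h i
      simpa [toC] using this)
    have h := hB.dotProduct_mulVec_pos hz
    have e : star (toC x) ⬝ᵥ (covMatrix ρ X + (covMatrix ρ X)ᵀ) *ᵥ toC x
        = ((2 * (star x ⬝ᵥ rePart (covMatrix ρ X) *ᵥ x) : ℝ) : ℂ) := by
      simp only [dotProduct, mulVec, Finset.mul_sum, Complex.ofReal_sum]
      refine Finset.sum_congr rfl fun i _ => Finset.sum_congr rfl fun j _ => ?_
      have : covMatrix ρ X i j + covMatrix ρ X j i = ((2 * (covMatrix ρ X i j).re : ℝ) : ℂ) := by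
        rw [hconj i j]
        exact Complex.add_conj _
      simp only [Matrix.add_apply, transpose_apply, this]
      simp [toC, rePart]
      ring
    rw [e] at h
    have h' : 0 < 2 * (star x ⬝ᵥ rePart (covMatrix ρ X) *ᵥ x) := by exact_mod_cast h
    linarith

/-- The cross-covariance matrix of a `𝒟_ρ`-invariant family is the geometric mean `Σ # Σᵀ`. -/
theorem isGeometricMean_crossCovMatrix (hρ : ρ.PosSemidef) (hXh : ∀ i, (X i).IsHermitian)
    (hX : LinearIndependent ℝ fun i => (kerSpace ρ).mkQ (X i))
    (hinv : IsCommutationInvariant ρ (Submodule.span ℝ (Set.range X))) :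
    IsGeometricMean (covMatrix ρ X) (covMatrix ρ X)ᵀ (crossCovMatrix ρ X) := by
  refine ⟨crossCovMatrix_posSemidef hρ hXh, posSemidef_fromBlocks_covMatrix hρ hXh,
    fun M hM hMb => ?_⟩
  have hS := covMatrix_posSemidef hρ hXh
  have hB := covMatrix_add_transpose_posDef hρ hXh hX
  obtain ⟨W, α, hW, hWB, hWS⟩ := exists_simultaneous_diagonalization hB hS.isHermitian
  obtain ⟨a, ha⟩ := exists_commutation_coeff hinv
  have hWT : Wᴴ * (covMatrix ρ X)ᵀ * W = diagonal fun k => ((1 - α k : ℝ) : ℂ) := by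
    have : Wᴴ * (covMatrix ρ X)ᵀ * W = 1 - diagonal fun k => (α k : ℂ) := by
      rw [← hWB, ← hWS, Matrix.mul_add, Matrix.add_mul, add_sub_cancel_left]
    rw [this, ← diagonal_one, diagonal_sub]
    congr 1
    ext k
    simp
  have hα0 : ∀ k, 0 ≤ α k := fun k => by
    have := hS.conjTranspose_mul_mul_same W
    rw [hWS, posSemidef_diagonal_iff] at this
    exact_mod_cast this k
  have hα1 : ∀ k, 0 ≤ 1 - α k := fun k => by
    have := hS.transpose.conjTranspose_mul_mul_same W
    rw [hWT, posSemidef_diagonal_iff] at this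
    exact_mod_cast this k
  -- The relation defining `a`, paired with `X k`.
  have hBa : (covMatrix ρ X + (covMatrix ρ X)ᵀ) * a = covMatrix ρ X := by
    ext k j
    rw [covMatrix_apply, ha j, mul_apply]
    simp only [covMatrix_add_transpose_apply, Matrix.mul_sum, trace_sum, Matrix.mul_smul,
      trace_smul, smul_eq_mul, mul_comm]
  have hWWB : W * (Wᴴ * (covMatrix ρ X + (covMatrix ρ X)ᵀ)) = 1 := mul_eq_one_comm.1 hWB
  -- Since `W⁻¹ = Wᴴ B`, the columns of `W` are eigenvectors of `a` with eigenvalues `α k`. The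
  -- operators they define are therefore eigenvectors in the sense of `sandwich_of_eigen`.
  have haW : a * W = W * diagonal fun k => (α k : ℂ) := by
    calc a * W = W * (Wᴴ * (covMatrix ρ X + (covMatrix ρ X)ᵀ)) * a * W := by
          rw [hWWB, Matrix.one_mul]
      _ = W * (Wᴴ * ((covMatrix ρ X + (covMatrix ρ X)ᵀ) * a) * W) := by
          simp only [Matrix.mul_assoc]
      _ = W * diagonal fun k => (α k : ℂ) := by rw [hBa, hWS]
  have heig : ∀ k, ρ * comb (fun i => W i k) X
      = (α k : ℂ) • (ρ * comb (fun i => W i k) X + comb (fun i => W i k) X * ρ) := by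
    intro k
    have hlhs : ρ * comb (fun i => W i k) X = ∑ i, (a * W) i k • (ρ * X i + X i * ρ) := by
      simp only [comb, Matrix.mul_sum, Matrix.mul_smul, mul_apply, Finset.sum_smul]
      rw [Finset.sum_comm]
      refine Finset.sum_congr rfl fun j _ => ?_
      rw [ha j, Finset.smul_sum]
      refine Finset.sum_congr rfl fun i _ => ?_
      rw [smul_smul, mul_comm]
    refine hlhs.trans ?_
    rw [haW]
    simp only [mul_diagonal, comb, Matrix.mul_sum, Matrix.sum_mul, ← Finset.sum_add_distrib,
      Finset.smul_sum]
    refine Finset.sum_congr rfl fun i _ => ?_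
    rw [Matrix.mul_smul, Matrix.smul_mul, ← smul_add, smul_smul, mul_comm]
  have hsand : ∀ k, msqrt ρ * comb (fun i => W i k) X * msqrt ρ
      = ((Real.sqrt (α k * (1 - α k)) : ℝ) : ℂ) •
        (ρ * comb (fun i => W i k) X + comb (fun i => W i k) X * ρ) := by
    intro k
    have h := sandwich_of_eigen (msqrt_posSemidef hρ) (Z := comb (fun i => W i k) X) (hα0 k)
      (by linarith [hα1 k])
    rw [msqrt_mul_msqrt hρ] at h
    exact h (heig k)
  have hAW : crossCovMatrix ρ X * W = (covMatrix ρ X + (covMatrix ρ X)ᵀ) * W *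
      diagonal fun k => ((Real.sqrt (α k * (1 - α k)) : ℝ) : ℂ) := by
    ext i k
    have h := congrArg (fun N => (X i * N).trace) (hsand k)
    have h1 : (X i * (msqrt ρ * comb (fun i => W i k) X * msqrt ρ)).trace
        = (crossCovMatrix ρ X * W) i k := by
      simp only [mul_apply, crossCovMatrix_apply, comb, Matrix.mul_sum, Matrix.sum_mul, trace_sum,
        Matrix.mul_smul, Matrix.smul_mul, trace_smul, smul_eq_mul, mul_comm]
    have h2 : (X i * (ρ * comb (fun i => W i k) X + comb (fun i => W i k) X * ρ)).trace
        = ((covMatrix ρ X + (covMatrix ρ X)ᵀ) * W) i k := by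
      simp only [mul_apply, covMatrix_add_transpose_apply, comb, Matrix.mul_sum, Matrix.sum_mul,
        trace_sum, Matrix.mul_smul, Matrix.smul_mul, trace_smul, smul_eq_mul, Matrix.mul_add,
        trace_add, ← Finset.sum_add_distrib]
      refine Finset.sum_congr rfl fun j _ => ?_
      ring
    rw [Matrix.mul_smul, trace_smul, h1, h2, smul_eq_mul] at h
    rw [h, mul_diagonal, mul_comm]
  refine sub_posSemidef_of_congruence hW hα0 hα1 (fun k => by simp) hWS hWT ?_ hM.isHermitian hMb
  rw [Matrix.mul_assoc, hAW, ← Matrix.mul_assoc, ← Matrix.mul_assoc, hWB, Matrix.one_mul]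

end Gram

/-! ### Tensor powers -/

section Tensor

variable {ι : Type*} [Fintype ι] {n : ℕ}

lemma tensor_mul (A B : Fin n → Matrix ι ι ℂ) :
    tensor A * tensor B = tensor fun k => A k * B k := by
  classical
  ext f g
  simp only [tensor, mul_apply, of_apply, Finset.prod_univ_sum, Fintype.piFinset_univ,
    Finset.prod_mul_distrib]

lemma trace_tensor (A : Fin n → Matrix ι ι ℂ) : (tensor A).trace = ∏ k, (A k).trace := by
  classical
  simp only [trace, diag_apply, tensor, of_apply, Finset.prod_univ_sum, Fintype.piFinset_univ]

lemma conjTranspose_tensor {ι : Type*} (A : Fin n → Matrix ι ι ℂ) :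
    (tensor A)ᴴ = tensor fun k => (A k)ᴴ := by
  ext f g
  simp [tensor]

variable [DecidableEq ι]

lemma tensor_one {ι : Type*} [DecidableEq ι] :
    tensor (fun _ : Fin n => (1 : Matrix ι ι ℂ)) = 1 := by
  ext f g
  simp only [tensor, of_apply, one_apply, Finset.prod_ite_zero, Finset.prod_const_one,
    Finset.mem_univ, true_implies, funext_iff]

/-- The tensor power, as a monoid homomorphism. -/
def tensorPowHom (n : ℕ) : Matrix ι ι ℂ →* Matrix (Fin n → ι) (Fin n → ι) ℂ where
  toFun := tensorPow n
  map_one' := tensor_one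
  map_mul' A B := (tensor_mul (fun _ => A) fun _ => B).symm

lemma tensorPow_mul (A B : Matrix ι ι ℂ) :
    tensorPow n (A * B) = tensorPow n A * tensorPow n B :=
  map_mul (tensorPowHom n) A B

lemma trace_tensorPow {ι : Type*} [Fintype ι] (A : Matrix ι ι ℂ) :
    (tensorPow n A).trace = A.trace ^ n := by
  simp [tensorPow, trace_tensor]

lemma tensorPow_posSemidef {A : Matrix ι ι ℂ} (hA : A.PosSemidef) :
    (tensorPow n A).PosSemidef := by
  have h := posSemidef_conjTranspose_mul_self (tensorPow n (msqrt A))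
  rwa [tensorPow, conjTranspose_tensor, (msqrt_posSemidef hA).isHermitian.eq, tensor_mul,
    msqrt_mul_msqrt hA] at h

lemma msqrt_tensorPow {A : Matrix ι ι ℂ} (hA : A.PosSemidef) :
    msqrt (tensorPow n A) = tensorPow n (msqrt A) :=
  msqrt_unique (tensorPow_posSemidef (msqrt_posSemidef hA))
    (by rw [← tensorPow_mul, msqrt_mul_msqrt hA])

lemma tensor_update_apply {ι : Type*} [DecidableEq ι] (k : Fin n) (A : Matrix ι ι ℂ)
    (f g : Fin n → ι) :
    tensor (Function.update (fun _ => (1 : Matrix ι ι ℂ)) k A) f g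
      = A (f k) (g k) * ∏ j ∈ Finset.univ.erase k, (1 : Matrix ι ι ℂ) (f j) (g j) := by
  rw [tensor, of_apply, ← Finset.mul_prod_erase _ _ (Finset.mem_univ k), Function.update_self]
  congr 1
  refine Finset.prod_congr rfl fun j hj => ?_
  rw [Function.update_of_ne (Finset.ne_of_mem_erase hj)]

/-- The embedding `A ↦ I ⊗ ⋯ ⊗ A ⊗ ⋯ ⊗ I` with `A` at the `k`-th place. -/
def place (k : Fin n) : Matrix ι ι ℂ →ₐ[ℂ] Matrix (Fin n → ι) (Fin n → ι) ℂ :=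
  AlgHom.ofLinearMap
    { toFun := fun A => tensor (Function.update (fun _ => (1 : Matrix ι ι ℂ)) k A)
      map_add' := fun A B => by
        ext f g
        simp only [Matrix.add_apply, tensor_update_apply, add_mul]
      map_smul' := fun c A => by
        ext f g
        simp only [Matrix.smul_apply, tensor_update_apply, smul_eq_mul, RingHom.id_apply, mul_assoc] }
    (by
      change tensor (Function.update (fun _ => (1 : Matrix ι ι ℂ)) k 1) = 1
      rw [Function.update_eq_self_iff.2 rfl, tensor_one])
    (fun A B => by
      change tensor _ = tensor _ * tensor _
      rw [tensor_mul]
      congr 1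
      ext j : 1
      rcases eq_or_ne j k with rfl | hj
      · simp
      · simp [Function.update_of_ne hj])

lemma place_apply (k : Fin n) (A : Matrix ι ι ℂ) :
    place k A = tensor (Function.update (fun _ => (1 : Matrix ι ι ℂ)) k A) := rfl

lemma continuous_place (k : Fin n) : Continuous (place (ι := ι) k) := by
  refine continuous_matrix fun f g => ?_
  simp only [place_apply, tensor_update_apply]
  fun_prop

lemma commute_place {j k : Fin n} (hjk : j ≠ k) (A B : Matrix ι ι ℂ) :
    Commute (place j A) (place k B) := by
  rw [Commute, SemiconjBy, place_apply, place_apply, tensor_mul, tensor_mul]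
  congr 1
  ext i : 1
  rcases eq_or_ne i j with rfl | hij
  · simp [Function.update_of_ne hjk]
  · simp [Function.update_of_ne hij]

lemma place_exp (k : Fin n) (A : Matrix ι ι ℂ) :
    place k (NormedSpace.exp A) = NormedSpace.exp (place k A) := by
  open scoped Matrix.Norms.Operator in
  exact NormedSpace.map_exp (place k) (continuous_place k) A

/-- The summands commute, so the exponential splits. A general subset `s` allows induction. -/
lemma exp_sum_place (A : Matrix ι ι ℂ) (s : Finset (Fin n)) :
    NormedSpace.exp (∑ k ∈ s, place k A)
      = tensor fun k => if k ∈ s then NormedSpace.exp A else 1 := by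
  classical
  induction s using Finset.induction_on with
  | empty => simp [tensor_one]
  | insert k s hk ih =>
    rw [Finset.sum_insert hk, Matrix.exp_add_of_commute, ih, ← place_exp, place_apply, tensor_mul]
    · congr 1
      ext j : 1
      rcases eq_or_ne j k with rfl | hj
      · simp [hk]
      · simp [hj]
    · exact Commute.sum_right _ _ _ fun j hj =>
        commute_place (ne_of_mem_of_not_mem hj hk).symm A A

lemma iidSum_eq_sum_place (A : Matrix ι ι ℂ) :
    iidSum n A = (((Real.sqrt n)⁻¹ : ℝ) : ℂ) • ∑ k : Fin n, place k A := rfl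

lemma iidSum_isHermitian {A : Matrix ι ι ℂ} (hA : A.IsHermitian) : (iidSum n A).IsHermitian := by
  rw [IsHermitian, iidSum_eq_sum_place, conjTranspose_smul, conjTranspose_sum]
  congr 1
  · simp
  · refine Finset.sum_congr rfl fun k _ => ?_
    rw [place_apply, conjTranspose_tensor]
    congr 1
    ext j : 1
    rcases eq_or_ne j k with rfl | hj
    · simp [hA.eq]
    · simp [Function.update_of_ne hj]

lemma lin_iidSum {r : ℕ} (ξ : Fin r → ℝ) (X : Fin r → Matrix ι ι ℂ) :
    lin ξ (fun i => iidSum n (X i)) = iidSum n (lin ξ X) := by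
  simp only [lin, iidSum_eq_sum_place, map_sum, map_smul, Finset.smul_sum]
  rw [Finset.sum_comm]
  refine Finset.sum_congr rfl fun k _ => Finset.sum_congr rfl fun i _ => ?_
  rw [smul_comm]

lemma expI_iidSum (A : Matrix ι ι ℂ) :
    expI (iidSum n A)
      = tensorPow n (NormedSpace.exp ((((Real.sqrt n)⁻¹ : ℝ) : ℂ) • (Complex.I • A))) := by
  have h := exp_sum_place (n := n) ((((Real.sqrt n)⁻¹ : ℝ) : ℂ) • (Complex.I • A)) Finset.univ
  simp only [Finset.mem_univ, if_true] at h
  rw [tensorPow, ← h, expI, iidSum_eq_sum_place]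
  simp only [map_smul, ← Finset.smul_sum]
  rw [smul_comm]

end Tensor

/-! ### Second-order expansions -/

section Expansion

open Asymptotics

variable {𝔸 : Type*} [NormedRing 𝔸] [NormedAlgebra ℂ 𝔸]

/-- The expansion `f z = a + z b + z² c + o(z²)` as `z → 0`. -/
def HasQuadraticExpansion (f : ℂ → 𝔸) (a b c : 𝔸) : Prop :=
  (fun z => f z - (a + z • b + z ^ 2 • c)) =o[𝓝 0] fun z : ℂ => z ^ 2

lemma HasQuadraticExpansion.const (a : 𝔸) : HasQuadraticExpansion (fun _ => a) a 0 0 := by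
  simp [HasQuadraticExpansion]

lemma HasQuadraticExpansion.mul {f g : ℂ → 𝔸} {a b c a' b' c' : 𝔸}
    (hf : HasQuadraticExpansion f a b c) (hg : HasQuadraticExpansion g a' b' c') :
    HasQuadraticExpansion (fun z => f z * g z) (a * a') (a * b' + b * a')
      (a * c' + b * b' + c * a') := by
  have hP : (fun z : ℂ => a + z • b + z ^ 2 • c) =O[𝓝 0] fun _ => (1 : ℂ) :=
    (Continuous.tendsto (by fun_prop) 0).isBigO_one ℂ
  have hQ : (fun z : ℂ => a' + z • b' + z ^ 2 • c') =O[𝓝 0] fun _ => (1 : ℂ) :=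
    (Continuous.tendsto (by fun_prop) 0).isBigO_one ℂ
  have hz2 : (fun z : ℂ => z ^ 2) =O[𝓝 0] fun _ => (1 : ℂ) :=
    (Continuous.tendsto (by fun_prop) 0).isBigO_one ℂ
  have hgO : g =O[𝓝 0] fun _ => (1 : ℂ) := by
    simpa using (hg.isBigO.trans hz2).add hQ
  have h1 : (fun z => (f z - (a + z • b + z ^ 2 • c)) * g z) =o[𝓝 0] fun z : ℂ => z ^ 2 := by
    simpa using hf.mul_isBigO hgO
  have h2 : (fun z => (a + z • b + z ^ 2 • c) * (g z - (a' + z • b' + z ^ 2 • c')))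
      =o[𝓝 0] fun z : ℂ => z ^ 2 := by
    simpa using hP.mul_isLittleO hg
  -- The terms of order `z³` and `z⁴` in the product of the two quadratic polynomials.
  have h3 : (fun z : ℂ => z ^ 3 • (b * c' + c * b' + z • (c * c'))) =o[𝓝 0]
      fun z : ℂ => z ^ 2 := by
    have hR : (fun z : ℂ => b * c' + c * b' + z • (c * c')) =O[𝓝 0] fun _ => (1 : ℂ) :=
      (Continuous.tendsto (by fun_prop) 0).isBigO_one ℂ
    simpa using (isLittleO_pow_pow (𝕜 := ℂ) (by norm_num : 2 < 3)).smul_isBigO hR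
  refine ((h1.add h2).add h3).congr_left fun z => ?_
  simp only [sub_mul, mul_sub, add_mul, mul_add, smul_mul_assoc, mul_smul_comm, smul_add, smul_smul]
  module

lemma hasQuadraticExpansion_exp [CompleteSpace 𝔸] (B : 𝔸) :
    HasQuadraticExpansion (fun z => NormedSpace.exp (z • B)) 1 B ((1 / 2 : ℂ) • (B * B)) := by
  have h := (NormedSpace.exp_hasFPowerSeriesAt_zero (𝕂 := ℂ)
    (𝔸 := 𝔸)).isBigO_sub_partialSum_pow 3
  have ht : Tendsto (fun z : ℂ => z • B) (𝓝 0) (𝓝 0) := by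
    have : Continuous fun z : ℂ => z • B := by fun_prop
    simpa using this.tendsto 0
  have h1 := h.comp_tendsto ht
  have h2 : (fun z : ℂ => ‖z • B‖ ^ 3) =o[𝓝 0] fun z : ℂ => z ^ 2 := by
    have : (fun z : ℂ => z • B) =O[𝓝 0] fun z : ℂ => z :=
      IsBigO.of_bound ‖B‖ (Eventually.of_forall fun z => by rw [norm_smul, mul_comm])
    exact (this.norm_left.pow 3).trans_isLittleO (isLittleO_pow_pow (by norm_num))
  refine (h1.trans_isLittleO h2).congr_left fun z => ?_
  simp only [Function.comp_apply, zero_add, FormalMultilinearSeries.partialSum,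
    Finset.sum_range_succ, Finset.sum_range_zero, NormedSpace.expSeries_apply_eq]
  simp [pow_two, smul_smul, mul_comm]

/-- Splitting off the first factor keeps the order in the cross terms `B t * B u`, `t < u`. This
order is what makes the limiting covariance a complex Hermitian matrix instead of its real part. -/
lemma HasQuadraticExpansion.list_prod_exp [CompleteSpace 𝔸] {T : ℕ} (B : Fin T → 𝔸) :
    HasQuadraticExpansion (fun z => (List.ofFn fun t => NormedSpace.exp (z • B t)).prod) 1
      (∑ t, B t) ((1 / 2 : ℂ) • ∑ t, B t * B t + ∑ t, ∑ u ∈ Finset.Ioi t, B t * B u) := by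
  induction T with
  | zero => simpa using HasQuadraticExpansion.const (1 : 𝔸)
  | succ T ih =>
    have h := (hasQuadraticExpansion_exp (B 0)).mul (ih fun t => B t.succ)
    simp only [List.ofFn_succ, List.prod_cons, Fin.sum_univ_succ, Fin.sum_Ioi_zero,
      Fin.sum_Ioi_succ]
    convert! h using 1
    · simp
    · simp [add_comm]
    · simp only [one_mul, mul_one, smul_add, Finset.mul_sum]
      abel

lemma HasQuadraticExpansion.map {𝔹 : Type*} [NormedRing 𝔹] [NormedAlgebra ℂ 𝔹]
    (φ : 𝔸 →L[ℂ] 𝔹) {f : ℂ → 𝔸} {a b c : 𝔸} (hf : HasQuadraticExpansion f a b c) :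
    HasQuadraticExpansion (fun z => φ (f z)) (φ a) (φ b) (φ c) := by
  refine ((φ.isBigO_comp _ _).trans_isLittleO hf).congr_left fun z => ?_
  simp

/-- At `z = n^{-1/2}` the value is `1 + c / n + o(1 / n)`. The vanishing linear coefficient encodes
zero mean. -/
lemma HasQuadraticExpansion.tendsto_pow {f : ℂ → ℂ} {c : ℂ} (hf : HasQuadraticExpansion f 1 0 c) :
    Tendsto (fun n : ℕ => f (((Real.sqrt n)⁻¹ : ℝ) : ℂ) ^ n) atTop (𝓝 (Complex.exp c)) := by
  have ht : Tendsto (fun n : ℕ => (((Real.sqrt n)⁻¹ : ℝ) : ℂ)) atTop (𝓝 0) := by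
    rw [← Complex.ofReal_zero]
    exact (Complex.continuous_ofReal.tendsto 0).comp
      (tendsto_inv_atTop_zero.comp (Real.tendsto_sqrt_atTop.comp tendsto_natCast_atTop_atTop))
  have hsq : ∀ n : ℕ, ((((Real.sqrt n)⁻¹ : ℝ) : ℂ)) ^ 2 = (n : ℂ)⁻¹ := fun n => by
    rw [← Complex.ofReal_pow, inv_pow, Real.sq_sqrt (Nat.cast_nonneg n)]
    simp
  have h := (hf.comp_tendsto ht).tendsto_div_nhds_zero
  have key : Tendsto (fun n : ℕ => (n : ℂ) * (f (((Real.sqrt n)⁻¹ : ℝ) : ℂ) - 1)) atTop (𝓝 c) := by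
    have h' := h.add_const c
    rw [zero_add] at h'
    refine h'.congr' ?_
    filter_upwards [eventually_ne_atTop 0] with n hn
    have hn' : (n : ℂ) ≠ 0 := Nat.cast_ne_zero.2 hn
    simp only [Function.comp_apply, hsq, smul_eq_mul]
    field_simp
    ring
  refine (Complex.tendsto_one_add_pow_exp_of_tendsto key).congr fun n => ?_
  rw [add_sub_cancel]

end Expansion

/-! ### The quantum central limit theorem -/

section CentralLimit

variable {ι : Type*} [Fintype ι] [DecidableEq ι]

lemma hasQuadraticExpansion_trace_list {T : ℕ} (M : Matrix ι ι ℂ) (B : Fin T → Matrix ι ι ℂ) :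
    HasQuadraticExpansion
      (fun z => (M * (List.ofFn fun t => NormedSpace.exp (z • B t)).prod).trace) M.trace
      (M * ∑ t, B t).trace
      (M * ((1 / 2 : ℂ) • ∑ t, B t * B t + ∑ t, ∑ u ∈ Finset.Ioi t, B t * B u)).trace := by
  open scoped Matrix.Norms.Operator in
  have h := ((HasQuadraticExpansion.const M).mul
    (HasQuadraticExpansion.list_prod_exp B)).map
      (LinearMap.toContinuousLinearMap (traceLinearMap ι ℂ ℂ))
  simp only [mul_one, zero_mul, add_zero] at h
  exact h

lemma hasQuadraticExpansion_trace_sandwich (s B C : Matrix ι ι ℂ) :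
    HasQuadraticExpansion
      (fun z => (s * NormedSpace.exp (z • B) * s * NormedSpace.exp (z • C)).trace) (s * s).trace
      (s * s * C + s * B * s).trace
      (s * s * ((1 / 2 : ℂ) • (C * C)) + s * B * s * C
        + s * ((1 / 2 : ℂ) • (B * B)) * s).trace := by
  open scoped Matrix.Norms.Operator in
  have h := ((((HasQuadraticExpansion.const s).mul (hasQuadraticExpansion_exp B)).mul
    (HasQuadraticExpansion.const s)).mul (hasQuadraticExpansion_exp C)).map
      (LinearMap.toContinuousLinearMap (traceLinearMap ι ℂ ℂ))
  simp only [mul_one, mul_zero, zero_mul, add_zero, zero_add] at h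
  exact h

variable {r : ℕ} {ρ : Matrix ι ι ℂ} {X : Fin r → Matrix ι ι ℂ}

lemma trace_mul_lin (hmean : ∀ i, (ρ * X i).trace = 0) (ξ : Fin r → ℝ) :
    (ρ * lin ξ X).trace = 0 := by
  simp [lin, Matrix.mul_sum, hmean]

lemma trace_lin_mul_lin_eq_covMatrix (ξ η : Fin r → ℝ) :
    (ρ * (lin ξ X * lin η X)).trace
      = ∑ i, ∑ j, (ξ i : ℂ) * (η j : ℂ) * covMatrix ρ X j i := by
  have h := trace_lin_mul_lin (X := X) ξ η ρ 1
  simpa [Matrix.mul_assoc, covMatrix] using h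

theorem convergesToGaussian_iidSum (hρ : IsState ρ) (hmean : ∀ i, (ρ * X i).trace = 0) :
    ConvergesToGaussian (fun n => tensorPow n ρ) (fun n i => iidSum n (X i)) 0
      (covMatrix ρ X) := by
  intro T ξ
  have h := hasQuadraticExpansion_trace_list ρ fun t => Complex.I • lin (ξ t) X
  have hb : (ρ * ∑ t, Complex.I • lin (ξ t) X).trace = 0 := by
    simp [Matrix.mul_sum, trace_mul_lin hmean]
  rw [hb, hρ.trace_eq_one] at h
  convert! h.tendsto_pow using 1
  · ext n
    simp only [lin_iidSum, expI_iidSum]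
    rw [← trace_tensorPow, tensorPow_mul]
    -- The ordered product of tensor powers is the tensor power of the product, so the trace is an
    -- `n`-th power.
    have := map_list_prod (tensorPowHom (ι := ι) n) (List.ofFn fun t =>
      NormedSpace.exp ((((Real.sqrt n)⁻¹ : ℝ) : ℂ) • (Complex.I • lin (ξ t) X)))
    rw [List.map_ofFn] at this
    exact congrArg (fun N => (tensorPow n ρ * N).trace) this.symm
  · rw [gaussianQuasiChar]
    congr 2
    simp only [Matrix.mul_add, trace_add, Matrix.mul_smul, trace_smul, trace_sum,
      Matrix.smul_mul, trace_lin_mul_lin_eq_covMatrix, smul_smul, Complex.I_mul_I, smul_eq_mul,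
      Pi.zero_apply, Complex.ofReal_zero, mul_zero, Finset.sum_const_zero, zero_sub, neg_mul,
      one_mul, Finset.sum_neg_distrib, Finset.mul_sum]
    simp [Finset.mul_sum, sub_eq_add_neg]

theorem tendsto_sandwiched_iidSum (hρ : IsState ρ) (hmean : ∀ i, (ρ * X i).trace = 0)
    (ξ η : Fin r → ℝ) :
    Tendsto (fun n => (msqrt (tensorPow n ρ) * expI (lin ξ fun i => iidSum n (X i)) *
        msqrt (tensorPow n ρ) * expI (lin η fun i => iidSum n (X i))).trace) atTop
      (𝓝 (Complex.exp (-(1 / 2) * (toC (Sum.elim ξ η) ⬝ᵥ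
        (fromBlocks (covMatrix ρ X) (crossCovMatrix ρ X) (crossCovMatrix ρ X)
          (covMatrix ρ X)ᵀ).mulVec (toC (Sum.elim ξ η)))))) := by
  have hs := msqrt_mul_msqrt hρ.posSemidef
  have h := hasQuadraticExpansion_trace_sandwich (msqrt ρ) (Complex.I • lin ξ X)
    (Complex.I • lin η X)
  have hcyc : ∀ M : Matrix ι ι ℂ, (msqrt ρ * M * msqrt ρ).trace = (ρ * M).trace := fun M => by
    rw [trace_mul_comm, ← Matrix.mul_assoc, hs]
  have hb : (msqrt ρ * msqrt ρ * (Complex.I • lin η X)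
      + msqrt ρ * (Complex.I • lin ξ X) * msqrt ρ).trace = 0 := by
    rw [trace_add, hcyc, hs]
    simp [trace_mul_lin hmean]
  rw [hb, hs, hρ.trace_eq_one] at h
  convert! h.tendsto_pow using 1
  · ext n
    simp only [lin_iidSum, expI_iidSum, msqrt_tensorPow hρ.posSemidef]
    rw [← trace_tensorPow, tensorPow_mul, tensorPow_mul, tensorPow_mul]
  · congr 2
    rw [trace_add, trace_add, hcyc]
    simp only [Matrix.mul_smul, Matrix.smul_mul, trace_smul, smul_smul, smul_eq_mul,
      trace_lin_mul_lin_eq_covMatrix, trace_lin_mul_lin]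
    have hv : toC (Sum.elim ξ η) = Sum.elim (toC ξ) (toC η) := by
      ext k; cases k <;> rfl
    -- `A` is symmetric by cyclicity of the trace, so the two off-diagonal blocks contribute equally
    -- and absorb the factor `1 / 2`.
    have hsymm : toC η ⬝ᵥ crossCovMatrix ρ X *ᵥ toC ξ
        = toC ξ ⬝ᵥ crossCovMatrix ρ X *ᵥ toC η := by
      have ht : (crossCovMatrix ρ X)ᵀ = crossCovMatrix ρ X := by
        ext i j
        simp only [transpose_apply, crossCovMatrix, of_apply]
        rw [Matrix.mul_assoc (msqrt ρ * X j), trace_mul_comm, Matrix.mul_assoc (msqrt ρ * X i)]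
      rw [dotProduct_mulVec, ← mulVec_transpose, ht, dotProduct_comm]
    rw [hv, fromBlocks_mulVec, sumElim_dotProduct_sumElim]
    simp only [Sum.elim_comp_inl, Sum.elim_comp_inr]
    rw [dotProduct_add, dotProduct_add, hsymm]
    have e1 : toC ξ ⬝ᵥ covMatrix ρ X *ᵥ toC ξ
        = ∑ i, ∑ j, (ξ i : ℂ) * (ξ j : ℂ) * covMatrix ρ X j i := by
      rw [Finset.sum_comm]
      simp only [dotProduct, mulVec, toC, Finset.mul_sum]
      refine Finset.sum_congr rfl fun i _ => Finset.sum_congr rfl fun j _ => ?_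
      ring
    have e2 : toC η ⬝ᵥ (covMatrix ρ X)ᵀ *ᵥ toC η
        = ∑ i, ∑ j, (η i : ℂ) * (η j : ℂ) * covMatrix ρ X j i := by
      simp only [dotProduct, mulVec, toC, Finset.mul_sum, transpose_apply]
      refine Finset.sum_congr rfl fun i _ => Finset.sum_congr rfl fun j _ => ?_
      ring
    have e3 : toC ξ ⬝ᵥ crossCovMatrix ρ X *ᵥ toC η
        = ∑ i, ∑ j, (ξ i : ℂ) * (η j : ℂ) * (msqrt ρ * X i * msqrt ρ * X j).trace := by
      simp only [dotProduct, mulVec, toC, Finset.mul_sum, crossCovMatrix, of_apply]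
      refine Finset.sum_congr rfl fun i _ => Finset.sum_congr rfl fun j _ => ?_
      ring
    rw [e1, e2, e3]
    simp only [mul_assoc, Complex.I_mul_I]
    ring

end CentralLimit

/-! ### D-extensions of the i.i.d. model -/

section DExtension

variable {ι : Type*} [Fintype ι] {d r : ℕ}

lemma card_le_of_span_le {L : Fin d → Matrix ι ι ℂ} {X : Fin r → Matrix ι ι ℂ}
    (h : Submodule.span ℝ (Set.range L) ≤ Submodule.span ℝ (Set.range X))
    (hL : LinearIndependent ℝ L) : d ≤ r := by
  have h1 := finrank_span_eq_card hL
  have h2 := Submodule.finrank_mono h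
  have h3 := finrank_range_le_card (R := ℝ) X
  rw [Set.finrank] at h3
  simp only [Fintype.card_fin] at h1 h3
  omega

variable [DecidableEq ι]

/-- If the scaled sums of `L` converge in distribution to a Gaussian state with nondegenerate
covariance, then `L` is linearly independent. -/
lemma linearIndependent_of_convergesToGaussian {ρ : Matrix ι ι ℂ} (hρ : IsState ρ)
    {L : Fin d → Matrix ι ι ℂ} {J : Matrix (Fin d) (Fin d) ℂ} (hJ : (rePart J).PosDef)
    (h : ConvergesToGaussian (fun n => tensorPow n ρ) (fun n k => iidSum n (L k)) 0 J) :
    LinearIndependent ℝ L := by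
  rw [Fintype.linearIndependent_iff]
  intro g hg
  by_contra hne
  have hg0 : g ≠ 0 := fun h0 => hne fun i => congrFun h0 i
  have hlin : lin g L = 0 := by rw [lin_eq_sum_smul, hg]
  have hlim := h 1 fun _ => g
  -- A vanishing combination of the `L k` gives the observable zero for every `n`, hence
  -- characteristic function `1` at `g`. The limit has modulus `exp (-(1 / 2) gᵀ (Re J) g) < 1`.
  have hone : ∀ n, (tensorPow n ρ * (List.ofFn fun _ : Fin 1 =>
      expI (lin g fun k => iidSum n (L k))).prod).trace = 1 := fun n => by
    rw [lin_iidSum, hlin, iidSum_eq_sum_place]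
    simp [expI, trace_tensorPow, hρ.trace_eq_one]
  simp only [hone] at hlim
  have hexp := tendsto_nhds_unique hlim tendsto_const_nhds
  have hpos := hJ.dotProduct_mulVec_pos hg0
  have hnorm := congrArg norm hexp
  rw [gaussianQuasiChar, Complex.norm_exp, norm_one, Real.exp_eq_one_iff] at hnorm
  have hform : (∑ i, ∑ j, (g i : ℂ) * (g j : ℂ) * J j i).re = star g ⬝ᵥ rePart J *ᵥ g := by
    rw [Finset.sum_comm]
    simp only [Complex.re_sum, dotProduct, mulVec, Finset.mul_sum, rePart, map_apply]
    refine Finset.sum_congr rfl fun i _ => Finset.sum_congr rfl fun j _ => ?_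
    rw [← Complex.ofReal_mul, Complex.re_ofReal_mul]
    simp only [star_trivial]
    ring
  have hre : ((1 / 2 : ℂ) * ∑ i, ∑ j, (g i : ℂ) * (g j : ℂ) * J j i).re
      = 1 / 2 * (star g ⬝ᵥ rePart J *ᵥ g) := by
    rw [← hform, ← Complex.re_ofReal_mul]
    norm_num
  have hIoi : (Finset.Ioi (0 : Fin 1)) = ∅ := by decide
  simp only [Finset.univ_unique, Fin.default_eq_zero, Finset.sum_singleton, Pi.zero_apply,
    Complex.ofReal_zero, mul_zero, Finset.sum_const_zero, zero_sub, hIoi, Finset.sum_empty,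
    sub_zero, Complex.neg_re, hre] at hnorm
  linarith

theorem exists_dExtensionConditions_iid {ρ : Matrix ι ι ℂ} (hρ : IsState ρ)
    {L : Fin d → Matrix ι ι ℂ} {X : Fin r → Matrix ι ι ℂ} (hX : IsInvariantExtension ρ X L)
    (hXind : LinearIndependent ℝ fun i => (kerSpace ρ).mkQ (X i))
    (hmean : ∀ i, (ρ * X i).trace = 0) :
    ∃ F : Matrix (Fin r) (Fin d) ℝ,
      DExtensionConditions (fun n => tensorPow n ρ) (fun n k => iidSum n (L k))
        (fun n i => iidSum n (X i)) F (covMatrix ρ X) := by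
  have hF : ∀ k, ∃ c : Fin r → ℝ, lin c X = L k := fun k => by
    obtain ⟨c, hc⟩ := (Submodule.mem_span_range_iff_exists_fun ℝ).1
      (hX.span_le (Submodule.subset_span ⟨k, rfl⟩))
    exact ⟨c, by rw [lin_eq_sum_smul, hc]⟩
  choose c hc using hF
  exact ⟨Matrix.of fun i k => c k i,
    { isHermitian := fun n i => iidSum_isHermitian (hX.isHermitian i)
      eq_lin := fun n k => by
        rw [← hc k, ← lin_iidSum]
        rfl
      posSemidef := covMatrix_posSemidef hρ.posSemidef hX.isHermitian
      re_posDef := rePart_covMatrix_posDef hρ.posSemidef hX.isHermitian hXind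
      converges := convergesToGaussian_iidSum hρ hmean
      sandwiched := ⟨crossCovMatrix ρ X,
        isGeometricMean_crossCovMatrix hρ.posSemidef hX.isHermitian hXind hX.invariant,
        tendsto_sandwiched_iidSum hρ hmean⟩ }⟩

end DExtension

end QuantumIID

end

theorem theoremC1 {ι : Type*} [Fintype ι] [DecidableEq ι] {d r : ℕ}
    (Θ : Set (Fin d → ℝ)) (ρ : (Fin d → ℝ) → Matrix ι ι ℂ)
    (hρ : ∀ θ ∈ Θ, QuantumIID.IsState (ρ θ))
    (θ₀ : Fin d → ℝ) (hθ₀ : Θ ∈ 𝓝 θ₀)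
    (L : Fin d → Matrix ι ι ℂ) (hL : QuantumIID.IsSLD ρ θ₀ L)
    (X : Fin r → Matrix ι ι ℂ) (hX : QuantumIID.IsInvariantExtension (ρ θ₀) X L)
    (hXind : LinearIndependent ℝ fun i => (QuantumIID.kerSpace (ρ θ₀)).mkQ (X i))
    (hXmean : ∀ i, (ρ θ₀ * X i).trace = 0) :
    -- the three conditions of a D-extension, with `Σ_{ij} = Tr ρ X_j X_i`
    (∃ F : Matrix (Fin r) (Fin d) ℝ,
      QuantumIID.DExtensionConditions
        (fun n => QuantumIID.tensorPow n (ρ θ₀))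
        (fun n k => QuantumIID.iidSum n (L k))
        (fun n i => QuantumIID.iidSum n (X i))
        F (QuantumIID.covMatrix (ρ θ₀) X)) ∧
    -- the cross-covariance is `Σ # Σᵀ`
    QuantumIID.IsGeometricMean (QuantumIID.covMatrix (ρ θ₀) X)
      (QuantumIID.covMatrix (ρ θ₀) X).transpose (QuantumIID.crossCovMatrix (ρ θ₀) X) ∧
    -- `r ≥ d` as soon as the SLDs are linearly independent
    (LinearIndependent ℝ L → d ≤ r) ∧
    -- the i.i.d. extension is D-extendible at `θ₀` in every case where it is q-LAN there
    (∀ J : Matrix (Fin d) (Fin d) ℂ,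
      QuantumIID.IsQLAN Θ (fun n θ => QuantumIID.tensorPow n (ρ θ)) θ₀
        (fun n k => QuantumIID.iidSum n (L k)) J →
      d ≤ r ∧
      QuantumIID.IsDExtendible Θ (fun n θ => QuantumIID.tensorPow n (ρ θ)) θ₀
        (fun n k => QuantumIID.iidSum n (L k)) J) := by
  have hstate := hρ θ₀ (mem_of_mem_nhds hθ₀)
  have hext := QuantumIID.exists_dExtensionConditions_iid hstate hX hXind hXmean
  refine ⟨hext, QuantumIID.isGeometricMean_crossCovMatrix hstate.posSemidef hX.isHermitian hXind
    hX.invariant, QuantumIID.card_le_of_span_le hX.span_le, fun J hJ => ?_⟩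
  -- Independence of the `L k` is not assumed here; it follows from the nondegenerate Gaussian limit
  -- in q-LAN.
  have hdr : d ≤ r := QuantumIID.card_le_of_span_le hX.span_le
    (QuantumIID.linearIndependent_of_convergesToGaussian hstate hJ.re_posDef hJ.converges)
  obtain ⟨F, hF⟩ := hext
  exact ⟨hdr, hJ, r, hdr, _, F, _, hF⟩
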